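/- Let $(M,J,g)$ be an almost Norden manifold: $M$ is a smooth finite-dimensional manifold, $g$ a pseudo-Riemannian metric on $M$ and $J$ an almost complex structure with $g(Jx,Jy)=-g(x,y)$. Let $\nabla$ be the Levi-Civita connection of $g$, with curvature $R(X,Y)Z=\nabla_X\nabla_YZ-\nabla_Y\nabla_XZ-\nabla_{[X,Y]}Z$ and $R(X,Y,Z,W)=g(R(X,Y)Z,W)$, and let $F(X,Y,Z)=g((\nabla_XJ)Y,Z)$. Let $X^H$ and $X^V$ denote the horizontal (with respect to $\nabla$) and vertical lifts to the tangent bundle $TM$ of a vector field $X$ on $M$. On $TM$ consider the tensor fields $J_1,J_2,J_3$ and the metric $\hat g$ (the complete lift of $g$) determined by $$J_1X^H=-(JX)^H,\quad J_1X^V=(JX)^V,\qquad J_2X^H=X^V,\quad J_2X^V=-X^H,\qquad J_3X^H=(JX)^V,\quad J_3X^V=(JX)^H,$$ $$\hat g(X^H,Y^H)=\hat g(X^V,Y^V)=0,\qquad \hat g(X^H,Y^V)=\hat g(X^V,Y^H)=g(X,Y).$$ Let $\hat\nabla$ be the Levi-Civita connection of $\hat g$ and, for $\alpha=1,2,3$,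 let $F_\alpha(\hat X,\hat Y,\hat Z)=\hat g((\hat\nabla_{\hat X}J_\alpha)\hat Y,\hat Z)$. Then for all smooth vector fields $X,Y,Z$ on $M$, at every $u\in T_pM\subset TM$ (the right-hand sides being evaluated at $p$), $$F_1(X^H,Y^H,Z^H)=-R(u,X,JY,Z)-R(u,X,Y,JZ),$$ $$F_1(X^H,Y^H,Z^V)=-F_1(X^H,Y^V,Z^H)=-F(X,Y,Z);$$ $$F_2(X^H,Y^H,Z^V)=-F_2(X^H,Y^V,Z^H)=R(u,X,Y,Z);$$ $$F_3(X^H,Y^H,Z^H)=F_3(X^H,Y^V,Z^V)=F(X,Y,Z),$$ $$F_3(X^H,Y^H,Z^V)=-R(u,X,Y,JZ),\qquad F_3(X^H,Y^V,Z^H)=R(u,X,JY,Z),$$ and all other components of $F_1,F_2,F_3$ on triples of horizontal and vertical lifts vanish; that is, $F_1(X^H,Y^V,Z^V)=F_2(X^H,Y^H,Z^H)=F_2(X^H,Y^V,Z^V)=0$, and $F_\alpha(X^V,\cdot,\cdot)=0$ on all pairs of lifts for $\alpha=1,2,3$. -/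

import Mathlib

open Bundle
open scoped Manifold ContDiff

noncomputable section

/-! ### Levi-Civita connection, curvature and structure tensors on an arbitrary manifold -/

section General

variable {E : Type*} [NormedAddCommGroup E] [NormedSpace ℝ E]
  {H : Type*} [TopologicalSpace H] {I : ModelWithCorners ℝ E H}
  {M : Type*} [TopologicalSpace M] [ChartedSpace H M] [IsManifold I 1 M]

/-- `cov` (where `cov Y x (X x)` is `(∇_X Y)(x)`) is the Levi-Civita connection of the
pseudo-Riemannian metric `g`: a smooth affine connection that is torsion free and satisfies
`X g(Y, Z) = g(∇_X Y, Z) + g(Y, ∇_X Z)`. -/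
structure IsLeviCivita
    (g : Π x : M, TangentSpace I x →L[ℝ] TangentSpace I x →L[ℝ] ℝ)
    (cov : CovariantDerivative I E (TangentSpace I : M → Type _)) : Prop where
  smooth : ∀ (X Y : Π x : M, TangentSpace I x) (x : M),
    CMDiffAt ∞ (T% X) x → CMDiffAt ∞ (T% Y) x → CMDiffAt ∞ (T% (fun y ↦ cov Y y (X y))) x
  torsion_free : ∀ (X Y : Π x : M, TangentSpace I x) (x : M),
    MDiffAt (T% X) x → MDiffAt (T% Y) x →
      cov Y x (X x) - cov X x (Y x) = VectorField.mlieBracket I X Y x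
  metric : ∀ (X Y Z : Π x : M, TangentSpace I x) (x : M),
    MDiffAt (T% Y) x → MDiffAt (T% Z) x →
      d% (fun y ↦ g y (Y y) (Z y)) x (X x)
        = g x (cov Y x (X x)) (Z x) + g x (Y x) (cov Z x (X x))

/-- `R(X, Y)Z = ∇_X ∇_Y Z - ∇_Y ∇_X Z - ∇_[X, Y] Z`. -/
def curvatureOp (cov : CovariantDerivative I E (TangentSpace I : M → Type _))
    (X Y Z : Π x : M, TangentSpace I x) (x : M) : TangentSpace I x :=
  cov (fun y ↦ cov Z y (Y y)) x (X x) - cov (fun y ↦ cov Z y (X y)) x (Y x)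
    - cov Z x (VectorField.mlieBracket I X Y x)

/-- The curvature tensor of type `(0, 4)`, `R(X, Y, Z, W) = g(R(X, Y)Z, W)`. -/
def curvatureForm (g : Π x : M, TangentSpace I x →L[ℝ] TangentSpace I x →L[ℝ] ℝ)
    (cov : CovariantDerivative I E (TangentSpace I : M → Type _))
    (X Y Z W : Π x : M, TangentSpace I x) (x : M) : ℝ :=
  g x (curvatureOp cov X Y Z x) (W x)

/-- The structure tensor `F(X, Y, Z) = g((∇_X J)Y, Z)` of a field of endomorphisms `J`, where
`(∇_X J)Y = ∇_X (JY) - J(∇_X Y)`. -/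
def structureTensor (g : Π x : M, TangentSpace I x →L[ℝ] TangentSpace I x →L[ℝ] ℝ)
    (cov : CovariantDerivative I E (TangentSpace I : M → Type _))
    (J : Π x : M, TangentSpace I x →L[ℝ] TangentSpace I x)
    (X Y Z : Π x : M, TangentSpace I x) (x : M) : ℝ :=
  g x (cov (fun y ↦ J y (Y y)) x (X x) - J x (cov Y x (X x))) (Z x)

end General

section TangentBundleLifts

variable {E : Type*} [NormedAddCommGroup E] [NormedSpace ℝ E]
  {M : Type*} [TopologicalSpace M] [ChartedSpace E M] [IsManifold 𝓘(ℝ, E) ∞ M]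

variable (E M) in
/-- An almost Norden structure `(J, g)` on `M`: a pseudo-Riemannian metric `g` and an almost complex
structure `J` which is an anti-isometry of `g` (so `g` is automatically of neutral signature). -/
structure AlmostNordenStructure where
  g : Π x : M, TangentSpace 𝓘(ℝ, E) x →L[ℝ] TangentSpace 𝓘(ℝ, E) x →L[ℝ] ℝ
  g_symm : ∀ (x : M) (v w : TangentSpace 𝓘(ℝ, E) x), g x v w = g x w v
  g_nondegenerate : ∀ (x : M) (v : TangentSpace 𝓘(ℝ, E) x), (∀ w, g x v w = 0) → v = 0
  g_smooth : ContMDiff 𝓘(ℝ, E) (𝓘(ℝ, E).prod 𝓘(ℝ, E →L[ℝ] E →L[ℝ] ℝ)) ∞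
    (fun x : M ↦ TotalSpace.mk' (E →L[ℝ] E →L[ℝ] ℝ)
      (E := fun x : M ↦ TangentSpace 𝓘(ℝ, E) x →L[ℝ] TangentSpace 𝓘(ℝ, E) x →L[ℝ] ℝ) x (g x))
  J : Π x : M, TangentSpace 𝓘(ℝ, E) x →L[ℝ] TangentSpace 𝓘(ℝ, E) x
  J_smooth : ContMDiff 𝓘(ℝ, E) (𝓘(ℝ, E).prod 𝓘(ℝ, E →L[ℝ] E)) ∞
    (fun x : M ↦ TotalSpace.mk' (E →L[ℝ] E)
      (E := fun x : M ↦ TangentSpace 𝓘(ℝ, E) x →L[ℝ] TangentSpace 𝓘(ℝ, E) x) x (J x))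
  J_sq : ∀ (x : M) (v : TangentSpace 𝓘(ℝ, E) x), J x (J x v) = -v
  norden : ∀ (x : M) (v w : TangentSpace 𝓘(ℝ, E) x), g x (J x v) (J x w) = -g x v w

/-- The vertical lift `T_p M → T_u (TM)`, `p = π u`: the derivative at `u` of the inclusion of the
fibre `T_p M` into `TM`. -/
def vLift (u : TangentBundle 𝓘(ℝ, E) M) :
    TangentSpace 𝓘(ℝ, E) u.1 →L[ℝ] TangentSpace 𝓘(ℝ, E).tangent u :=
  (mfderiv 𝓘(ℝ, E) 𝓘(ℝ, E).tangent
    (fun v : E ↦ (⟨u.1, v⟩ : TangentBundle 𝓘(ℝ, E) M)) u.2 : E →L[ℝ] E × E)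

/-- The derivative at `p = π u` of a local vector field `s` on `M` with `s(p) = u`. -/
def extendDeriv (u : TangentBundle 𝓘(ℝ, E) M) :
    TangentSpace 𝓘(ℝ, E) u.1 →L[ℝ] TangentSpace 𝓘(ℝ, E).tangent u :=
  (mfderiv 𝓘(ℝ, E) 𝓘(ℝ, E).tangent
    (fun q : M ↦ (⟨q, FiberBundle.extend E u.2 q⟩ : TangentBundle 𝓘(ℝ, E) M)) u.1 :
      E →L[ℝ] E × E)

/-- The horizontal lift `T_p M → T_u (TM)`, `p = π u`, with respect to `∇`:
`x^H = ds(x) - (∇_x s)^V` for a local vector field `s` on `M` with `s(p) = u`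
(the choice of `s` does not matter). -/
def hLift (nabla : CovariantDerivative 𝓘(ℝ, E) E (TangentSpace 𝓘(ℝ, E) : M → Type _))
    (u : TangentBundle 𝓘(ℝ, E) M) :
    TangentSpace 𝓘(ℝ, E) u.1 →L[ℝ] TangentSpace 𝓘(ℝ, E).tangent u :=
  extendDeriv u - (vLift u).comp (nabla (FiberBundle.extend E u.2) u.1)

/-- The differential of the projection `π : TM → M` at `u`. -/
def dProj (u : TangentBundle 𝓘(ℝ, E) M) :
    TangentSpace 𝓘(ℝ, E).tangent u →L[ℝ] TangentSpace 𝓘(ℝ, E) u.1 :=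
  mfderiv 𝓘(ℝ, E).tangent 𝓘(ℝ, E) (fun w : TangentBundle 𝓘(ℝ, E) M ↦ w.1) u

theorem fiber_trivialization (p : M) (v : E) :
    (trivializationAt E (TangentSpace 𝓘(ℝ, E)) p (⟨p, v⟩ : TangentBundle 𝓘(ℝ, E) M)).2 = v :=
  tangentCoordChange_self (I := 𝓘(ℝ, E)) (mem_extChartAt_source (I := 𝓘(ℝ, E)) p)

theorem mdifferentiableAt_fiber (p : M) (v : E) :
    MDifferentiableAt 𝓘(ℝ, E) 𝓘(ℝ, E).tangent
      (fun v : E ↦ (⟨p, v⟩ : TangentBundle 𝓘(ℝ, E) M)) v := by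
  refine (mdifferentiableAt_totalSpace 𝓘(ℝ, E) _).2
    ⟨mdifferentiableAt_const, ?_⟩
  have h : (fun v : E ↦ (trivializationAt E (TangentSpace 𝓘(ℝ, E)) p
      (⟨p, v⟩ : TangentBundle 𝓘(ℝ, E) M)).2) = id := funext (fiber_trivialization p)
  have h2 : MDifferentiableAt 𝓘(ℝ, E) 𝓘(ℝ, E) (fun v : E ↦
      (trivializationAt E (TangentSpace 𝓘(ℝ, E)) p
      (⟨p, v⟩ : TangentBundle 𝓘(ℝ, E) M)).2) v := by
    rw [h]; exact mdifferentiableAt_id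
  exact h2

theorem dProj_vLift (u : TangentBundle 𝓘(ℝ, E) M) (w : TangentSpace 𝓘(ℝ, E) u.1) :
    dProj u (vLift u w) = 0 := by
  obtain ⟨p, (v : E)⟩ := u
  have h1 : HasMFDerivAt 𝓘(ℝ, E).tangent 𝓘(ℝ, E) (fun w : TangentBundle 𝓘(ℝ, E) M ↦ w.1)
      (⟨p, v⟩ : TangentBundle 𝓘(ℝ, E) M) (dProj ⟨p, v⟩) :=
    (mdifferentiableAt_proj (TangentSpace 𝓘(ℝ, E))).hasMFDerivAt
  have h := h1.comp v (f := fun v : E ↦ (⟨p, v⟩ : TangentBundle 𝓘(ℝ, E) M))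
    (mdifferentiableAt_fiber p v).hasMFDerivAt
  have h0 := hasMFDerivAt_unique h
    (hasMFDerivAt_const (I := 𝓘(ℝ, E)) (I' := 𝓘(ℝ, E)) (M := E) p (v : E))
  exact DFunLike.congr_fun h0 w

theorem dProj_extendDeriv (u : TangentBundle 𝓘(ℝ, E) M) (x : TangentSpace 𝓘(ℝ, E) u.1) :
    dProj u (extendDeriv u x) = x := by
  obtain ⟨p, v⟩ := u
  have hs : FiberBundle.extend E v p = v := FiberBundle.extend_apply_self E v
  have h1 : HasMFDerivAt 𝓘(ℝ, E).tangent 𝓘(ℝ, E) (fun w : TangentBundle 𝓘(ℝ, E) M ↦ w.1)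
      (⟨p, FiberBundle.extend E v p⟩ : TangentBundle 𝓘(ℝ, E) M) (dProj ⟨p, v⟩) := by
    rw [hs]
    exact (mdifferentiableAt_proj (TangentSpace 𝓘(ℝ, E))).hasMFDerivAt
  have h := h1.comp p
    (f := fun q : M ↦ (⟨q, FiberBundle.extend E v q⟩ : TangentBundle 𝓘(ℝ, E) M))
    (FiberBundle.mdifferentiableAt_extend 𝓘(ℝ, E) E v).hasMFDerivAt
  have h0 := hasMFDerivAt_unique h (hasMFDerivAt_id p)
  exact DFunLike.congr_fun h0 x

theorem mdifferentiableAt_retraction (p : M) (v : E) :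
    MDifferentiableAt 𝓘(ℝ, E).tangent 𝓘(ℝ, E) (fun w : TangentBundle 𝓘(ℝ, E) M ↦
      (trivializationAt E (TangentSpace 𝓘(ℝ, E)) p w).2) ⟨p, v⟩ := by
  have h := (mdifferentiableAt_totalSpace 𝓘(ℝ, E) (x₀ := (⟨p, v⟩ : TangentBundle 𝓘(ℝ, E) M))
    (fun w : TangentBundle 𝓘(ℝ, E) M ↦ w)).1 mdifferentiableAt_id
  exact h.2

theorem hasMFDerivAt_retraction_fiber (p : M) (v : E) :
    HasMFDerivAt 𝓘(ℝ, E) 𝓘(ℝ, E)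
      ((fun w : TangentBundle 𝓘(ℝ, E) M ↦ (trivializationAt E (TangentSpace 𝓘(ℝ, E)) p w).2) ∘
        fun v : E ↦ (⟨p, v⟩ : TangentBundle 𝓘(ℝ, E) M)) v (ContinuousLinearMap.id ℝ E) := by
  have h : ((fun w : TangentBundle 𝓘(ℝ, E) M ↦
      (trivializationAt E (TangentSpace 𝓘(ℝ, E)) p w).2) ∘
        fun v : E ↦ (⟨p, v⟩ : TangentBundle 𝓘(ℝ, E) M)) = id := funext (fiber_trivialization p)
  rw [h]
  exact hasMFDerivAt_id v

theorem exists_vLift_leftInverse (p : M) (v : E) :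
    ∃ A : TangentSpace 𝓘(ℝ, E).tangent (⟨p, v⟩ : TangentBundle 𝓘(ℝ, E) M) →L[ℝ] E,
      ∀ w : E, A (vLift ⟨p, v⟩ w) = w := by
  have h := (mdifferentiableAt_retraction p v).hasMFDerivAt.comp v
    (mdifferentiableAt_fiber p v).hasMFDerivAt
  have h0 := hasMFDerivAt_unique h (hasMFDerivAt_retraction_fiber p v)
  exact ⟨_, fun w ↦ DFunLike.congr_fun h0 w⟩

theorem vLift_injective (u : TangentBundle 𝓘(ℝ, E) M) : Function.Injective (vLift u) := by
  obtain ⟨A, hA⟩ := exists_vLift_leftInverse (E := E) u.1 u.2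
  intro w w' h
  exact (hA w).symm.trans ((congrArg A h).trans (hA w'))

theorem dProj_hLift (nabla : CovariantDerivative 𝓘(ℝ, E) E (TangentSpace 𝓘(ℝ, E) : M → Type _))
    (u : TangentBundle 𝓘(ℝ, E) M) (x : TangentSpace 𝓘(ℝ, E) u.1) :
    dProj u (hLift nabla u x) = x := by
  change dProj u (extendDeriv u x - vLift u (nabla (FiberBundle.extend E u.2) u.1 x)) = x
  rw [map_sub, dProj_extendDeriv, dProj_vLift, sub_zero]

theorem lift_bijective [FiniteDimensional ℝ E]
    (nabla : CovariantDerivative 𝓘(ℝ, E) E (TangentSpace 𝓘(ℝ, E) : M → Type _))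
    (u : TangentBundle 𝓘(ℝ, E) M) :
    Function.Bijective ((hLift nabla u).coprod (vLift u)) := by
  have hinj : Function.Injective ((hLift nabla u).coprod (vLift u)) := by
    rw [injective_iff_map_eq_zero]
    rintro ⟨x, w⟩ h
    rw [ContinuousLinearMap.coprod_apply] at h
    have hx : x = 0 := by
      have := congrArg (dProj u) h
      rwa [map_add, dProj_hLift, dProj_vLift, add_zero, map_zero] at this
    subst hx
    rw [map_zero, zero_add] at h
    have hw : w = 0 := vLift_injective u (h.trans (map_zero _).symm)
    rw [hw]; rfl
  have : FiniteDimensional ℝ (TangentSpace 𝓘(ℝ, E) u.1) := inferInstanceAs (FiniteDimensional ℝ E)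
  have : FiniteDimensional ℝ (TangentSpace 𝓘(ℝ, E).tangent u) :=
    inferInstanceAs (FiniteDimensional ℝ (E × E))
  refine ⟨hinj, (LinearMap.injective_iff_surjective_of_finrank_eq_finrank
    (f := ((hLift nabla u).coprod (vLift u)).toLinearMap) ?_).1 hinj⟩
  rfl

/-- The splitting `T_p M × T_p M ≃ T_u (TM)`, `(x, w) ↦ x^H + w^V`, `p = π u`, of the tangent space
of `TM` into its horizontal and vertical subspaces. -/
def liftEquiv [FiniteDimensional ℝ E]
    (nabla : CovariantDerivative 𝓘(ℝ, E) E (TangentSpace 𝓘(ℝ, E) : M → Type _))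
    (u : TangentBundle 𝓘(ℝ, E) M) :
    (TangentSpace 𝓘(ℝ, E) u.1 × TangentSpace 𝓘(ℝ, E) u.1) ≃L[ℝ]
      TangentSpace 𝓘(ℝ, E).tangent u :=
  haveI : FiniteDimensional ℝ (TangentSpace 𝓘(ℝ, E) u.1) := inferInstanceAs (FiniteDimensional ℝ E)
  haveI : T2Space (TangentSpace 𝓘(ℝ, E) u.1) := inferInstanceAs (T2Space E)
  haveI : T2Space (TangentSpace 𝓘(ℝ, E).tangent u) := inferInstanceAs (T2Space (E × E))
  (LinearEquiv.ofBijective ((hLift nabla u).coprod (vLift u)).toLinearMap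
    (lift_bijective nabla u)).toContinuousLinearEquiv

@[simp] theorem liftEquiv_symm_hLift [FiniteDimensional ℝ E]
    (nabla : CovariantDerivative 𝓘(ℝ, E) E (TangentSpace 𝓘(ℝ, E) : M → Type _))
    (u : TangentBundle 𝓘(ℝ, E) M) (x : TangentSpace 𝓘(ℝ, E) u.1) :
    (liftEquiv nabla u).symm (hLift nabla u x) = (x, 0) := by
  rw [ContinuousLinearEquiv.symm_apply_eq]
  change _ = hLift nabla u x + vLift u 0
  rw [map_zero, add_zero]

@[simp] theorem liftEquiv_symm_vLift [FiniteDimensional ℝ E]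
    (nabla : CovariantDerivative 𝓘(ℝ, E) E (TangentSpace 𝓘(ℝ, E) : M → Type _))
    (u : TangentBundle 𝓘(ℝ, E) M) (x : TangentSpace 𝓘(ℝ, E) u.1) :
    (liftEquiv nabla u).symm (vLift u x) = (0, x) := by
  rw [ContinuousLinearEquiv.symm_apply_eq]
  change _ = hLift nabla u 0 + vLift u x
  rw [map_zero, zero_add]

/-- The horizontal component `x` of `x^H + w^V`. -/
def hPart [FiniteDimensional ℝ E]
    (nabla : CovariantDerivative 𝓘(ℝ, E) E (TangentSpace 𝓘(ℝ, E) : M → Type _))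
    (u : TangentBundle 𝓘(ℝ, E) M) :
    TangentSpace 𝓘(ℝ, E).tangent u →L[ℝ] TangentSpace 𝓘(ℝ, E) u.1 :=
  (ContinuousLinearMap.fst ℝ _ _).comp (liftEquiv nabla u).symm.toContinuousLinearMap

/-- The vertical component `w` of `x^H + w^V`. -/
def vPart [FiniteDimensional ℝ E]
    (nabla : CovariantDerivative 𝓘(ℝ, E) E (TangentSpace 𝓘(ℝ, E) : M → Type _))
    (u : TangentBundle 𝓘(ℝ, E) M) :
    TangentSpace 𝓘(ℝ, E).tangent u →L[ℝ] TangentSpace 𝓘(ℝ, E) u.1 :=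
  (ContinuousLinearMap.snd ℝ _ _).comp (liftEquiv nabla u).symm.toContinuousLinearMap

/-- The complete lift `ĝ` of `g`: `ĝ(x^H, y^H) = ĝ(x^V, y^V) = 0` and
`ĝ(x^H, y^V) = ĝ(x^V, y^H) = g(x, y)`. -/
def completeLift [FiniteDimensional ℝ E]
    (g : Π x : M, TangentSpace 𝓘(ℝ, E) x →L[ℝ] TangentSpace 𝓘(ℝ, E) x →L[ℝ] ℝ)
    (nabla : CovariantDerivative 𝓘(ℝ, E) E (TangentSpace 𝓘(ℝ, E) : M → Type _))
    (u : TangentBundle 𝓘(ℝ, E) M) :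
    TangentSpace 𝓘(ℝ, E).tangent u →L[ℝ] TangentSpace 𝓘(ℝ, E).tangent u →L[ℝ] ℝ :=
  ((vPart nabla u).precomp ℝ).comp ((g u.1).comp (hPart nabla u))
    + ((hPart nabla u).precomp ℝ).comp ((g u.1).comp (vPart nabla u))

/-- `J₁ : x^H ↦ -(Jx)^H, x^V ↦ (Jx)^V`. -/
def J1 [FiniteDimensional ℝ E]
    (nabla : CovariantDerivative 𝓘(ℝ, E) E (TangentSpace 𝓘(ℝ, E) : M → Type _))
    (J : Π x : M, TangentSpace 𝓘(ℝ, E) x →L[ℝ] TangentSpace 𝓘(ℝ, E) x)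
    (u : TangentBundle 𝓘(ℝ, E) M) :
    TangentSpace 𝓘(ℝ, E).tangent u →L[ℝ] TangentSpace 𝓘(ℝ, E).tangent u :=
  (vLift u).comp ((J u.1).comp (vPart nabla u))
    - (hLift nabla u).comp ((J u.1).comp (hPart nabla u))

/-- `J₂ : x^H ↦ x^V, x^V ↦ -x^H`. -/
def J2 [FiniteDimensional ℝ E]
    (nabla : CovariantDerivative 𝓘(ℝ, E) E (TangentSpace 𝓘(ℝ, E) : M → Type _))
    (u : TangentBundle 𝓘(ℝ, E) M) :
    TangentSpace 𝓘(ℝ, E).tangent u →L[ℝ] TangentSpace 𝓘(ℝ, E).tangent u :=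
  (vLift u).comp (hPart nabla u) - (hLift nabla u).comp (vPart nabla u)

/-- `J₃ : x^H ↦ (Jx)^V, x^V ↦ (Jx)^H`. -/
def J3 [FiniteDimensional ℝ E]
    (nabla : CovariantDerivative 𝓘(ℝ, E) E (TangentSpace 𝓘(ℝ, E) : M → Type _))
    (J : Π x : M, TangentSpace 𝓘(ℝ, E) x →L[ℝ] TangentSpace 𝓘(ℝ, E) x)
    (u : TangentBundle 𝓘(ℝ, E) M) :
    TangentSpace 𝓘(ℝ, E).tangent u →L[ℝ] TangentSpace 𝓘(ℝ, E).tangent u :=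
  (vLift u).comp ((J u.1).comp (hPart nabla u))
    + (hLift nabla u).comp ((J u.1).comp (vPart nabla u))

/-- The horizontal lift `X^H` of a vector field `X` on `M`, a vector field on `TM`. -/
def hField (nabla : CovariantDerivative 𝓘(ℝ, E) E (TangentSpace 𝓘(ℝ, E) : M → Type _))
    (X : Π x : M, TangentSpace 𝓘(ℝ, E) x) (u : TangentBundle 𝓘(ℝ, E) M) :
    TangentSpace 𝓘(ℝ, E).tangent u :=
  hLift nabla u (X u.1)

/-- The vertical lift `X^V` of a vector field `X` on `M`, a vector field on `TM`. -/
def vField (X : Π x : M, TangentSpace 𝓘(ℝ, E) x) (u : TangentBundle 𝓘(ℝ, E) M) :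
    TangentSpace 𝓘(ℝ, E).tangent u :=
  vLift u (X u.1)

end TangentBundleLifts

end

/-! By definition F_α(A, B, C) = ĝ(∇̂_A(J_α B), C) - ĝ(J_α ∇̂_A B, C). Each J_α sends a lift to plus
or minus a lift. With respect to ĝ, J₁ is skew-adjoint while J₂ and J₃ are self-adjoint, because J
is g-self-adjoint; so J_α in the second term can be moved onto C. Everything therefore reduces to
the eight numbers ĝ(∇̂_A B, C) with A, B, C horizontal or vertical lifts. They amount to ∇̂_{X^H}
Y^H = (∇_X Y)^H + (R(u, X)Y)^V, ∇̂_{X^H} Y^V = (∇_X Y)^V, ∇̂_{X^V} Y^H = ∇̂_{X^V} Y^V = 0, and the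
tables for F₁, F₂, F₃ follow by substitution.

The eight numbers come from Koszul's formula for ĝ, torsion-freeness and metric compatibility, once
the brackets of lifts are known. Only the pairings of brackets with lifts are needed, and these are
derivatives of functions: ĝ(ξ, Z^V) = g(dπ ξ, Z) sees only the projection of ξ, and ĝ(ξ, Z^H) =
ξ(g(Z, ·)) - g(∇_{dπ ξ} Z, u) sees ξ through the fibrewise linear function g(Z, ·) (`flatFun`).
Since X^H g(Z, ·) = g(∇_X Z, ·) and X^V g(Z, ·) = g(Z, X) ∘ π, the commutator formula
`mvfderiv_mlieBracket` gives [X^H, Y^V] = (∇_X Y)^V and [X^V, Y^V] = 0, while [X^H, Y^H] pairs with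
Z^H to g(R(X, Y)Z, u). The first Bianchi identity and the symmetries of R turn the three curvature
terms in Koszul's formula into 2R(u, X, Y, Z). -/

section

open Filter Topology VectorField

/-! ### Lie brackets as commutators of derivations. -/

section FunctionDerivation

variable {E : Type*} [NormedAddCommGroup E] [NormedSpace ℝ E]
  {H : Type*} [TopologicalSpace H] {I : ModelWithCorners ℝ E H}
  {M : Type*} [TopologicalSpace M] [ChartedSpace H M] [IsManifold I ∞ M]

theorem ContMDiffAt.eventually_mdifferentiableAt {E' : Type*} [NormedAddCommGroup E']
    [NormedSpace ℝ E'] {H' : Type*} [TopologicalSpace H'] {J : ModelWithCorners ℝ E' H'}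
    {N : Type*} [TopologicalSpace N] [ChartedSpace H' N] [IsManifold J ∞ N] {f : M → N} {x : M}
    (hf : ContMDiffAt I J ∞ f x) : ∀ᶠ y in 𝓝 x, MDifferentiableAt I J f y :=
  ((contMDiffAt_iff_contMDiffAt_nhds (by simp)).1 (hf.of_le ENat.LEInfty.out : ContMDiffAt I J 1 f x)).mono
    fun _ hy ↦ hy.mdifferentiableAt one_ne_zero

/-- The Lie bracket of vector fields acts on functions as the commutator of derivations: if
`fX = X f` and `fY = Y f` near `x`, then `[X, Y] f = X fY - Y fX` at `x`. -/
theorem mvfderiv_mlieBracket [CompleteSpace E] {X Y : Π x : M, TangentSpace I x}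
    {f fX fY : M → ℝ} {x : M}
    (hX : CMDiffAt ∞ (T% X) x) (hY : CMDiffAt ∞ (T% Y) x) (hf : CMDiffAt ∞ f x)
    (hfX : ∀ᶠ y in 𝓝 x, d% f y (X y) = fX y) (hfY : ∀ᶠ y in 𝓝 x, d% f y (Y y) = fY y)
    (hfX' : MDiffAt fX x) (hfY' : MDiffAt fY x) :
    d% f x (mlieBracket I X Y x) = d% fY x (X x) - d% fX x (Y x) := by
  have : IsManifold I (minSmoothness ℝ 3) M := by
    rw [minSmoothness_of_isRCLikeNormedField]; infer_instance
  have : IsManifold I (((⊤ : ℕ∞) : ℕ∞ω) + 1) M := inferInstanceAs (IsManifold I ∞ M)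
  have hmin : minSmoothness ℝ (((1 : ℕ∞) : ℕ∞ω) + 1) ≤ ((⊤ : ℕ∞) : ℕ∞ω) := by
    rw [minSmoothness_of_isRCLikeNormedField]; exact_mod_cast (le_top : (1 + 1 : ℕ∞) ≤ ⊤)
  -- The argument needs a field W that is nonzero at x; if the tangent space is trivial, both sides
  -- vanish.
  by_cases hw : ∃ w : TangentSpace I x, w ≠ 0
  swap
  · push Not at hw
    rw [hw (mlieBracket I X Y x), hw (X x), hw (Y x)]
    simp
  obtain ⟨w, hw⟩ := hw
  let W : Π x : M, TangentSpace I x := FiberBundle.extend E w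
  have hWx : W x = w := FiberBundle.extend_apply_self E w
  have hW : CMDiffAt ∞ (T% W) x := FiberBundle.contMDiffAt_extend I E w
  have hfd : ∀ᶠ y in 𝓝 x, MDiffAt f y :=
    hf.eventually_mdifferentiableAt
  have hWd := hW.eventually_mdifferentiableAt
  have hXW : MDiffAt (T% (mlieBracket I X W)) x :=
    (ContMDiffAt.mlieBracket_vectorField (m := 1) (n := ⊤) hX hW hmin).mdifferentiableAt one_ne_zero
  have hYW : MDiffAt (T% (mlieBracket I Y W)) x :=
    (ContMDiffAt.mlieBracket_vectorField (m := 1) (n := ⊤) hY hW hmin).mdifferentiableAt one_ne_zero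
  -- Leibniz rule applied twice to [A, [B, fW]]. The cross terms (Bf)[A, W] + (Af)[B, W] are
  -- symmetric in A and B, so they cancel when the Jacobi identity for X, Y, fW is compared with f
  -- times the one for X, Y, W. What remains is a multiple of W whose coefficient is the desired
  -- difference.
  have key : ∀ (A B : Π x : M, TangentSpace I x) (fB : M → ℝ),
      (∀ᶠ y in 𝓝 x, d% f y (B y) = fB y) → MDiffAt fB x → MDiffAt (T% (mlieBracket I B W)) x →
      mlieBracket I A (mlieBracket I B (f • W)) x
        = d% fB x (A x) • w + fB x • mlieBracket I A W x
          + (d% f x (A x) • mlieBracket I B W x + f x • mlieBracket I A (mlieBracket I B W) x) := by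
    intro A B fB hB hB' hBW
    have h1 : mlieBracket I B (f • W) =ᶠ[𝓝 x] fB • W + f • mlieBracket I B W := by
      filter_upwards [hB, hfd, hWd] with y hy hfy hWy
      rw [mlieBracket_smul_right hfy hWy, hy]
      rfl
    rw [EventuallyEq.rfl.mlieBracket_vectorField_eq h1,
      mlieBracket_add_right (hB'.smul_section hWd.self_of_nhds)
        (hfd.self_of_nhds.smul_section hBW),
      mlieBracket_smul_right hB' hWd.self_of_nhds, mlieBracket_smul_right hfd.self_of_nhds hBW, hWx]
  have h2 : minSmoothness ℝ 2 ≤ ∞ := by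
    rw [minSmoothness_of_isRCLikeNormedField]; exact ENat.LEInfty.out
  have jac := leibniz_identity_mlieBracket_apply (hX.of_le h2) (hY.of_le h2)
    ((hf.smul_section hW).of_le h2)
  have jac' := leibniz_identity_mlieBracket_apply (hX.of_le h2) (hY.of_le h2) (hW.of_le h2)
  have e1 := key X Y fY hfY hfY' hYW
  have e2 := key Y X fX hfX hfX' hXW
  have e3 := mlieBracket_smul_right (V := mlieBracket I X Y) hfd.self_of_nhds hWd.self_of_nhds
  have jac2 : mlieBracket I X (mlieBracket I Y (f • W)) x =
      mlieBracket I (mlieBracket I X Y) (f • W) x + mlieBracket I Y (mlieBracket I X (f • W)) x :=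
    jac
  rw [e1, e2, e3, jac', hfX.self_of_nhds, hfY.self_of_nhds, hWx] at jac2
  have : (d% f x (mlieBracket I X Y x) - (d% fY x (X x) - d% fX x (Y x))) • w = 0 := by
    rw [← sub_eq_zero.2 jac2.symm]; module
  rcases smul_eq_zero.1 this with h | h
  · linarith
  · exact absurd h hw

end FunctionDerivation

/-! ### Derivatives of functions on TM along horizontal and vertical vectors. -/

noncomputable section DerivativesAlongLifts

variable {E : Type*} [NormedAddCommGroup E] [NormedSpace ℝ E]
  {M : Type*} [TopologicalSpace M] [ChartedSpace E M] [IsManifold 𝓘(ℝ, E) ∞ M]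
  {F : Type*} [NormedAddCommGroup F] [NormedSpace ℝ F]

theorem mvfderiv_vLift {f : TangentBundle 𝓘(ℝ, E) M → F} {u : TangentBundle 𝓘(ℝ, E) M}
    (hf : MDiffAt f u) (w : TangentSpace 𝓘(ℝ, E) u.1) :
    d% f u (vLift u w) = fderiv ℝ (fun v : E ↦ f ⟨u.1, v⟩) u.2 w := by
  obtain ⟨p, (v : E)⟩ := u
  have h := hf.hasMFDerivAt.comp v (f := fun v : E ↦ (⟨p, v⟩ : TangentBundle 𝓘(ℝ, E) M))
    (mdifferentiableAt_fiber p v).hasMFDerivAt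
  exact (DFunLike.congr_fun (mfderiv_eq_fderiv.symm.trans h.mfderiv) w).symm

theorem mvfderiv_extendDeriv {f : TangentBundle 𝓘(ℝ, E) M → F} {u : TangentBundle 𝓘(ℝ, E) M}
    (hf : MDiffAt f u) (x : TangentSpace 𝓘(ℝ, E) u.1) :
    d% f u (extendDeriv u x)
      = d% (fun q : M ↦ f ⟨q, FiberBundle.extend E u.2 q⟩) u.1 x := by
  obtain ⟨p, v⟩ := u
  -- The extension takes the value v at p only up to a proof, so the differential of f is first
  -- transported to the base point required by the chain rule.
  have hs : FiberBundle.extend E v p = v := FiberBundle.extend_apply_self E v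
  have h1 : HasMFDerivAt 𝓘(ℝ, E).tangent 𝓘(ℝ, F) f
      (⟨p, FiberBundle.extend E v p⟩ : TangentBundle 𝓘(ℝ, E) M)
      (mfderiv 𝓘(ℝ, E).tangent 𝓘(ℝ, F) f ⟨p, v⟩) := by
    rw [hs]
    exact hf.hasMFDerivAt
  have h := h1.comp p
    (f := fun q : M ↦ (⟨q, FiberBundle.extend E v q⟩ : TangentBundle 𝓘(ℝ, E) M))
    (FiberBundle.mdifferentiableAt_extend 𝓘(ℝ, E) E v).hasMFDerivAt
  exact (DFunLike.congr_fun h.mfderiv x).symm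

theorem mvfderiv_hLift (nabla : CovariantDerivative 𝓘(ℝ, E) E (TangentSpace 𝓘(ℝ, E) : M → Type _))
    {f : TangentBundle 𝓘(ℝ, E) M → F} {u : TangentBundle 𝓘(ℝ, E) M}
    (hf : MDiffAt f u) (x : TangentSpace 𝓘(ℝ, E) u.1) :
    d% f u (hLift nabla u x)
      = d% (fun q : M ↦ f ⟨q, FiberBundle.extend E u.2 q⟩) u.1 x
        - fderiv ℝ (fun v : E ↦ f ⟨u.1, v⟩) u.2 (nabla (FiberBundle.extend E u.2) u.1 x) := by
  change d% f u (extendDeriv u x - vLift u (nabla (FiberBundle.extend E u.2) u.1 x)) = _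
  rw [map_sub, mvfderiv_extendDeriv hf]
  congr 1
  exact mvfderiv_vLift hf _

theorem mvfderiv_comp_proj {f : M → F} {u : TangentBundle 𝓘(ℝ, E) M} (hf : MDiffAt f u.1)
    (ξ : TangentSpace 𝓘(ℝ, E).tangent u) :
    d% (fun w : TangentBundle 𝓘(ℝ, E) M ↦ f w.1) u ξ = d% f u.1 (dProj u ξ) := by
  have h := hf.hasMFDerivAt.comp u (mdifferentiableAt_proj (TangentSpace 𝓘(ℝ, E))).hasMFDerivAt
  exact DFunLike.congr_fun h.mfderiv ξ

/-- The fibrewise linear function `u ↦ g(W, u)` on `TM` determined by a vector field `W`. -/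
def flatFun (g : Π x : M, TangentSpace 𝓘(ℝ, E) x →L[ℝ] TangentSpace 𝓘(ℝ, E) x →L[ℝ] ℝ)
    (W : Π x : M, TangentSpace 𝓘(ℝ, E) x) (u : TangentBundle 𝓘(ℝ, E) M) : ℝ :=
  g u.1 (W u.1) u.2

variable (S : AlmostNordenStructure E M)

namespace AlmostNordenStructure

/-- Put Jv for v in the Norden identity and use J² = -1. -/
theorem g_J_left (x : M) (v w : TangentSpace 𝓘(ℝ, E) x) :
    S.g x (S.J x v) w = S.g x v (S.J x w) := by
  have h := S.norden x (S.J x v) w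
  rw [S.J_sq, map_neg, _root_.neg_apply] at h
  linarith

theorem contMDiffAt_g_apply {V W : Π x : M, TangentSpace 𝓘(ℝ, E) x} {x : M}
    (hV : CMDiffAt ∞ (T% V) x) (hW : CMDiffAt ∞ (T% W) x) :
    CMDiffAt ∞ (fun y ↦ S.g y (V y) (W y)) x := by
  have h := ContMDiffAt.clm_bundle_apply₂ (F₁ := E) (F₂ := E) (F₃ := ℝ) (E₃ := Bundle.Trivial M ℝ)
    (S.g_smooth x) hV hW
  rw [contMDiffAt_totalSpace] at h
  exact h.2

theorem contMDiffAt_J_apply {V : Π x : M, TangentSpace 𝓘(ℝ, E) x} {x : M}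
    (hV : CMDiffAt ∞ (T% V) x) : CMDiffAt ∞ (T% (fun y ↦ S.J y (V y))) x :=
  ContMDiffAt.clm_bundle_apply (F₁ := E) (F₂ := E) (S.J_smooth x) hV

theorem contMDiffAt_flatFun {W : Π x : M, TangentSpace 𝓘(ℝ, E) x} {u : TangentBundle 𝓘(ℝ, E) M}
    (hW : CMDiffAt ∞ (T% W) u.1) : CMDiffAt ∞ (flatFun S.g W) u := by
  have hp : CMDiffAt ∞ (fun w : TangentBundle 𝓘(ℝ, E) M ↦ w.1) u :=
    contMDiffAt_proj (TangentSpace 𝓘(ℝ, E))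
  have h := ContMDiffAt.clm_bundle_apply₂ (F₁ := E) (F₂ := E) (F₃ := ℝ) (E₃ := Bundle.Trivial M ℝ)
    (b := fun w : TangentBundle 𝓘(ℝ, E) M ↦ w.1)
    ((S.g_smooth u.1).comp u hp) (hW.comp u hp)
    (contMDiffAt_id (x := u) (I := 𝓘(ℝ, E).tangent))
  rw [contMDiffAt_totalSpace] at h
  exact h.2

theorem mdifferentiableAt_flatFun {W : Π x : M, TangentSpace 𝓘(ℝ, E) x}
    {u : TangentBundle 𝓘(ℝ, E) M} (hW : MDiffAt (T% W) u.1) : MDiffAt (flatFun S.g W) u := by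
  have hp : MDiffAt (fun w : TangentBundle 𝓘(ℝ, E) M ↦ w.1) u :=
    mdifferentiableAt_proj (TangentSpace 𝓘(ℝ, E))
  have h := MDifferentiableAt.clm_bundle_apply₂ (F₁ := E) (F₂ := E) (F₃ := ℝ)
    (E₃ := Bundle.Trivial M ℝ) (b := fun w : TangentBundle 𝓘(ℝ, E) M ↦ w.1)
    (((S.g_smooth u.1).mdifferentiableAt (by simp)).comp u hp) (hW.comp u hp)
    (mdifferentiableAt_id (x := u) (I := 𝓘(ℝ, E).tangent))
  rw [mdifferentiableAt_totalSpace] at h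
  exact h.2

theorem fderiv_flatFun_fiber (W : Π x : M, TangentSpace 𝓘(ℝ, E) x)
    (u : TangentBundle 𝓘(ℝ, E) M) (w : TangentSpace 𝓘(ℝ, E) u.1) :
    fderiv ℝ (fun v : E ↦ flatFun S.g W ⟨u.1, v⟩) u.2 w = S.g u.1 (W u.1) w := by
  let L : E →L[ℝ] ℝ := S.g u.1 (W u.1)
  exact DFunLike.congr_fun (L.fderiv (x := u.2)) w

theorem mvfderiv_flatFun_vLift {W : Π x : M, TangentSpace 𝓘(ℝ, E) x}
    {u : TangentBundle 𝓘(ℝ, E) M} (hW : MDiffAt (T% W) u.1) (w : TangentSpace 𝓘(ℝ, E) u.1) :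
    d% (flatFun S.g W) u (vLift u w) = S.g u.1 (W u.1) w := by
  rw [mvfderiv_vLift (S.mdifferentiableAt_flatFun hW), S.fderiv_flatFun_fiber]

/-- Along a section s through u, metric compatibility gives x g(W, s) = g(∇_x W, s) + g(W, ∇_x s);
the vertical correction in the horizontal lift removes exactly the second term. -/
theorem mvfderiv_flatFun_hLift
    {nabla : CovariantDerivative 𝓘(ℝ, E) E (TangentSpace 𝓘(ℝ, E) : M → Type _)}
    (hnabla : IsLeviCivita S.g nabla) {W : Π x : M, TangentSpace 𝓘(ℝ, E) x}
    {u : TangentBundle 𝓘(ℝ, E) M} (hW : MDiffAt (T% W) u.1) (x : TangentSpace 𝓘(ℝ, E) u.1) :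
    d% (flatFun S.g W) u (hLift nabla u x) = S.g u.1 (nabla W u.1 x) u.2 := by
  rw [mvfderiv_hLift nabla (S.mdifferentiableAt_flatFun hW), S.fderiv_flatFun_fiber]
  have h := hnabla.metric (FiberBundle.extend E x) W (FiberBundle.extend E u.2) u.1 hW
    (FiberBundle.mdifferentiableAt_extend 𝓘(ℝ, E) E u.2)
  rw [FiberBundle.extend_apply_self, FiberBundle.extend_apply_self] at h
  rw [sub_eq_iff_eq_add]
  exact h

end AlmostNordenStructure

end DerivativesAlongLifts

/-! ### Smoothness of vector fields in a chart; vectors as derivations. -/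

section SmoothSections

variable {E : Type*} [NormedAddCommGroup E] [NormedSpace ℝ E]
  {H : Type*} [TopologicalSpace H] {I : ModelWithCorners ℝ E H}
  {M : Type*} [TopologicalSpace M] [ChartedSpace H M] [IsManifold I ∞ M]

theorem trivializationAt_tangentSpace_apply_snd {x y : M} (hy : y ∈ (chartAt H x).source)
    (v : TangentSpace I y) :
    (trivializationAt E (TangentSpace I) x ⟨y, v⟩).2 = d% (extChartAt I x) y v := by
  have h := DFunLike.congr_fun (TangentBundle.continuousLinearMapAt_trivializationAt (I := I) hy) v
  rw [Trivialization.continuousLinearMapAt_apply,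
    Trivialization.coe_linearMapAt_of_mem _
      (by rwa [TangentBundle.trivializationAt_baseSet])] at h
  exact h

theorem contMDiffAt_vectorField_iff {X : Π x : M, TangentSpace I x} {x : M} :
    CMDiffAt ∞ (T% X) x ↔ CMDiffAt ∞ (fun y ↦ d% (extChartAt I x) y (X y)) x := by
  rw [contMDiffAt_section]
  refine Filter.EventuallyEq.contMDiffAt_iff ?_
  filter_upwards [chart_source_mem_nhds H x] with y hy
    using trivializationAt_tangentSpace_apply_snd hy (X y)

theorem ContMDiffAt.mvfderiv_vectorField {F : Type*} [NormedAddCommGroup F] [NormedSpace ℝ F]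
    {f : M → F} {X : Π x : M, TangentSpace I x} {x : M}
    (hf : CMDiffAt ∞ f x) (hX : CMDiffAt ∞ (T% X) x) :
    CMDiffAt ∞ (fun y ↦ d% f y (X y)) x := by
  have h := ContMDiffAt.clm_apply_of_inCoordinates (F₁ := E) (F₂ := F)
    (E₁ := (TangentSpace I : M → Type _)) (E₂ := (TangentSpace 𝓘(ℝ, F) : F → Type _))
    (b₁ := id) (b₂ := f) (ϕ := mfderiv I 𝓘(ℝ, F) f) (hf.mfderiv_const (m := ∞) (by simp)) hX hf
  exact (contMDiff_snd_tangentBundle_modelSpace F 𝓘(ℝ, F)).contMDiffAt.comp x h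

/-- The test functions ℓ ∘ φ suffice, with φ the chart at x and ℓ a continuous functional: dφ is
injective and functionals separate points. -/
theorem eq_of_forall_mvfderiv_eq {x : M} {v w : TangentSpace I x}
    (h : ∀ f : M → ℝ, CMDiffAt ∞ f x → d% f x v = d% f x w) : v = w := by
  have hφ : CMDiffAt ∞ (extChartAt I x) x := contMDiffAt_extChartAt
  apply (isInvertible_mfderiv_extChartAt (I := I) (mem_extChartAt_source x)).injective
  refine (SeparatingDual.eq_iff_forall_dual_eq (R := ℝ) (V := E)).2 fun ℓ ↦ ?_
  have hc : ∀ z : TangentSpace I x, d% (fun y ↦ ℓ (extChartAt I x y)) x z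
      = ℓ (d% (extChartAt I x) x z) := fun z ↦ by
    have := (ℓ.hasMFDerivAt (x := extChartAt I x x)).comp x
      (hφ.mdifferentiableAt (by simp)).hasMFDerivAt
    exact DFunLike.congr_fun this.mfderiv z
  have := h (fun y ↦ ℓ (extChartAt I x y)) (ℓ.contMDiff.contMDiffAt.comp x hφ)
  rw [hc, hc] at this
  exact this

end SmoothSections

/-! ### Smoothness of horizontal and vertical lifts. -/

noncomputable section SmoothLifts

variable {E : Type*} [NormedAddCommGroup E] [NormedSpace ℝ E]
  {M : Type*} [TopologicalSpace M] [ChartedSpace E M] [IsManifold 𝓘(ℝ, E) ∞ M]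

/-- The fibre coordinate of `TM` in the trivialization at `p`. -/
def fiberCoord (p : M) (u : TangentBundle 𝓘(ℝ, E) M) : E :=
  (trivializationAt E (TangentSpace 𝓘(ℝ, E)) p u).2

theorem contMDiffAt_fiberCoord (u : TangentBundle 𝓘(ℝ, E) M) :
    CMDiffAt ∞ (fiberCoord (E := E) u.1) u :=
  (contMDiffAt_totalSpace.1
    (contMDiffAt_id (x := u) (I := 𝓘(ℝ, E).tangent) (n := ∞))).2

theorem contMDiffAt_proj_tangentBundle (u : TangentBundle 𝓘(ℝ, E) M) :
    CMDiffAt ∞ (fun w : TangentBundle 𝓘(ℝ, E) M ↦ w.1) u :=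
  contMDiffAt_proj (TangentSpace 𝓘(ℝ, E))

theorem extChartAt_tangentBundle (u : TangentBundle 𝓘(ℝ, E) M) :
    (extChartAt 𝓘(ℝ, E).tangent u : TangentBundle 𝓘(ℝ, E) M → E × E)
      = fun w ↦ (extChartAt 𝓘(ℝ, E) u.1 w.1, fiberCoord u.1 w) := by
  have h : extChartAt 𝓘(ℝ, E).tangent u = _ :=
    FiberBundle.extChartAt (IB := 𝓘(ℝ, E)) (F := E) (E := (TangentSpace 𝓘(ℝ, E) : M → Type _)) u
  funext w
  rw [h]
  rfl

/-- A vector field on `TM` is smooth if its components in the charts of `TM` are. -/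
theorem contMDiffAt_vectorField_tangentBundle
    {A : Π u : TangentBundle 𝓘(ℝ, E) M, TangentSpace 𝓘(ℝ, E).tangent u}
    {u : TangentBundle 𝓘(ℝ, E) M}
    (h₁ : CMDiffAt ∞ (fun w ↦ d% (extChartAt 𝓘(ℝ, E) u.1) w.1 (dProj w (A w))) u)
    (h₂ : CMDiffAt ∞ (fun w ↦ d% (fiberCoord (E := E) u.1) w (A w)) u) :
    CMDiffAt ∞ (T% A) u := by
  rw [contMDiffAt_vectorField_iff]
  refine (h₁.prodMk_space h₂).congr_of_eventuallyEq ?_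
  have hφ : CMDiffAt ∞ (extChartAt 𝓘(ℝ, E) u.1) u.1 := contMDiffAt_extChartAt
  filter_upwards [(contMDiffAt_fiberCoord u).eventually_mdifferentiableAt,
    (contMDiffAt_proj_tangentBundle u).continuousAt.eventually hφ.eventually_mdifferentiableAt]
    with w hw₂ hw₁
  have h₁ := hw₁.hasMFDerivAt.comp w
    (mdifferentiableAt_proj (TangentSpace 𝓘(ℝ, E))).hasMFDerivAt
  have h := (h₁.mdifferentiableAt.prodMk_space hw₂).hasMFDerivAt
  have hfst := hasMFDerivAt_unique
    (((ContinuousLinearMap.fst ℝ E E).hasMFDerivAt).comp w h) h₁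
  have hsnd := hasMFDerivAt_unique
    (((ContinuousLinearMap.snd ℝ E E).hasMFDerivAt).comp w h) hw₂.hasMFDerivAt
  rw [extChartAt_tangentBundle]
  exact Prod.ext (DFunLike.congr_fun hfst (A w)) (DFunLike.congr_fun hsnd (A w))

theorem continuousLinearMapAt_eq_fiberCoord {p q : M}
    (hq : q ∈ (trivializationAt E (TangentSpace 𝓘(ℝ, E)) p).baseSet) (v : TangentSpace 𝓘(ℝ, E) q) :
    (trivializationAt E (TangentSpace 𝓘(ℝ, E)) p).continuousLinearMapAt ℝ q v
      = fiberCoord p (⟨q, v⟩ : TangentBundle 𝓘(ℝ, E) M) := by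
  rw [Trivialization.continuousLinearMapAt_apply, Trivialization.coe_linearMapAt_of_mem _ hq]
  rfl

theorem mvfderiv_fiberCoord_vLift {p : M} {u : TangentBundle 𝓘(ℝ, E) M}
    (hu : u.1 ∈ (trivializationAt E (TangentSpace 𝓘(ℝ, E)) p).baseSet)
    (hd : MDiffAt (fiberCoord (E := E) p) u) (w : TangentSpace 𝓘(ℝ, E) u.1) :
    d% (fiberCoord (E := E) p) u (vLift u w)
      = fiberCoord p (⟨u.1, w⟩ : TangentBundle 𝓘(ℝ, E) M) := by
  rw [mvfderiv_vLift hd]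
  let L : E →L[ℝ] E :=
    (trivializationAt E (TangentSpace 𝓘(ℝ, E)) p).continuousLinearMapAt ℝ u.1
  have h : (fun v : E ↦ fiberCoord p (⟨u.1, v⟩ : TangentBundle 𝓘(ℝ, E) M)) = L :=
    funext fun v ↦ (continuousLinearMapAt_eq_fiberCoord hu v).symm
  rw [h]
  exact (DFunLike.congr_fun (L.fderiv (x := u.2)) w).trans
    (continuousLinearMapAt_eq_fiberCoord hu w)

theorem contMDiffAt_vField {X : Π x : M, TangentSpace 𝓘(ℝ, E) x} {u : TangentBundle 𝓘(ℝ, E) M}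
    (hX : CMDiffAt ∞ (T% X) u.1) : CMDiffAt ∞ (T% (vField X)) u := by
  refine contMDiffAt_vectorField_tangentBundle ?_ ?_
  · refine (contMDiffAt_const (c := (0 : E))).congr_of_eventuallyEq (.of_forall fun w ↦ ?_)
    change d% (extChartAt 𝓘(ℝ, E) u.1) w.1 (dProj w (vLift w (X w.1))) = 0
    rw [dProj_vLift, map_zero]
  · have h := ((contMDiffAt_section u.1).1 hX).comp u (contMDiffAt_proj_tangentBundle u)
    refine h.congr_of_eventuallyEq ?_
    filter_upwards [(contMDiffAt_fiberCoord u).eventually_mdifferentiableAt,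
      (contMDiffAt_proj_tangentBundle u).continuousAt.eventually
        ((trivializationAt E (TangentSpace 𝓘(ℝ, E)) u.1).open_baseSet.mem_nhds
          (FiberBundle.mem_baseSet_trivializationAt' u.1))] with w hw hw'
    exact mvfderiv_fiberCoord_vLift hw' hw _

theorem mdifferentiableAt_vField {X : Π x : M, TangentSpace 𝓘(ℝ, E) x}
    {u : TangentBundle 𝓘(ℝ, E) M} (hX : CMDiffAt ∞ (T% X) u.1) : MDiffAt (T% (vField X)) u :=
  (contMDiffAt_vField hX).mdifferentiableAt (by simp)

theorem mdifferentiableAt_comp_extend {F : Type*} [NormedAddCommGroup F] [NormedSpace ℝ F]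
    {f : TangentBundle 𝓘(ℝ, E) M → F} {u : TangentBundle 𝓘(ℝ, E) M} (hf : MDiffAt f u) :
    MDiffAt (fun q : M ↦ f ⟨q, FiberBundle.extend E u.2 q⟩) u.1 := by
  obtain ⟨p, v⟩ := u
  have hs : FiberBundle.extend E v p = v := FiberBundle.extend_apply_self E v
  have h1 : MDiffAt f (⟨p, FiberBundle.extend E v p⟩ : TangentBundle 𝓘(ℝ, E) M) := by
    rw [hs]
    exact hf
  exact h1.comp p (FiberBundle.mdifferentiableAt_extend 𝓘(ℝ, E) E v)

theorem CovariantDerivative.sum_smul_apply {ι : Type*}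
    (nabla : CovariantDerivative 𝓘(ℝ, E) E (TangentSpace 𝓘(ℝ, E) : M → Type _)) (t : Finset ι)
    {c : ι → M → ℝ} {s : ι → Π x : M, TangentSpace 𝓘(ℝ, E) x} {p : M}
    (hc : ∀ i, MDiffAt (c i) p) (hs : ∀ i, MDiffAt (T% (s i)) p) (x : TangentSpace 𝓘(ℝ, E) p) :
    nabla (fun q ↦ ∑ i ∈ t, c i q • s i q) p x
      = ∑ i ∈ t, (c i p • nabla (s i) p x + d% (c i) p x • s i p) := by
  classical
  induction t using Finset.induction_on with
  | empty =>
    have h : (fun q ↦ ∑ i ∈ (∅ : Finset ι), c i q • s i q)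
      = (0 : Π x : M, TangentSpace 𝓘(ℝ, E) x) := rfl
    rw [h, nabla.zero]
    rfl
  | insert a t ha ih =>
    have h : (fun q ↦ ∑ i ∈ insert a t, c i q • s i q)
        = c a • s a + fun q ↦ ∑ i ∈ t, c i q • s i q := by
      funext q
      rw [Finset.sum_insert ha]
      rfl
    have hsum : MDiffAt (T% (fun q ↦ ∑ i ∈ t, c i q • s i q)) p :=
      MDifferentiableAt.sum_section fun i _ ↦ (hc i).smul_section (hs i)
    rw [h, nabla.isCovariantDerivativeOnUniv.add ((hc a).smul_section (hs a)) hsum,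
      nabla.isCovariantDerivativeOnUniv.leibniz (hs a) (hc a), Finset.sum_insert ha, ← ih]
    rfl

/-- This is the coordinate expression -Γ(x, v) of the fibre component of a horizontal vector, with
the Christoffel symbols written as ∇ of a local frame. The definition of `hLift` uses an extension
of u chosen separately for each u; here the frame is fixed, which makes smooth dependence on u
visible. -/
theorem mvfderiv_fiberCoord_hLift {ι : Type*} [Fintype ι] (b : Module.Basis ι ℝ E)
    (nabla : CovariantDerivative 𝓘(ℝ, E) E (TangentSpace 𝓘(ℝ, E) : M → Type _))
    {p : M} {u : TangentBundle 𝓘(ℝ, E) M}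
    (hu : u.1 ∈ (trivializationAt E (TangentSpace 𝓘(ℝ, E)) p).baseSet)
    (hd : MDiffAt (fiberCoord (E := E) p) u) (x : TangentSpace 𝓘(ℝ, E) u.1) :
    d% (fiberCoord (E := E) p) u (hLift nabla u x)
      = -∑ i, b.repr (fiberCoord p u) i • fiberCoord p (⟨u.1, nabla
          ((trivializationAt E (TangentSpace 𝓘(ℝ, E)) p).localFrame b i) u.1 x⟩ :
            TangentBundle 𝓘(ℝ, E) M) := by
  set e := trivializationAt E (TangentSpace 𝓘(ℝ, E)) p with he
  let s : Π q : M, TangentSpace 𝓘(ℝ, E) q := FiberBundle.extend E u.2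
  have hsu : s u.1 = u.2 := FiberBundle.extend_apply_self E u.2
  have hs : MDiffAt (T% s) u.1 := FiberBundle.mdifferentiableAt_extend 𝓘(ℝ, E) E u.2
  let D : M → E := fun q ↦ fiberCoord p (⟨q, s q⟩ : TangentBundle 𝓘(ℝ, E) M)
  have hD : MDiffAt D u.1 := mdifferentiableAt_comp_extend hd
  let c : ι → M → ℝ := fun i q ↦ b.repr (D q) i
  let ℓ : ι → E →L[ℝ] ℝ := fun i ↦
    haveI := b.finiteDimensional_of_finite
    (b.coord i).toContinuousLinearMap
  have hc' : ∀ i, HasMFDerivAt 𝓘(ℝ, E) 𝓘(ℝ, ℝ) (c i) u.1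
      ((ℓ i).comp (mfderiv 𝓘(ℝ, E) 𝓘(ℝ, E) D u.1)) := fun i ↦
    ((ℓ i).hasMFDerivAt (x := D u.1)).comp u.1 hD.hasMFDerivAt
  have hdc : ∀ i, d% (c i) u.1 x = b.repr (d% D u.1 x) i := fun i ↦
    DFunLike.congr_fun (hc' i).mfderiv x
  have hfr : ∀ i, MDiffAt (T% (e.localFrame b i)) u.1 := fun i ↦
    (contMDiffAt_localFrame_of_mem (n := 1) e b i hu).mdifferentiableAt one_ne_zero
  let L : TangentSpace 𝓘(ℝ, E) u.1 →L[ℝ] E := e.continuousLinearMapAt ℝ u.1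
  have hL : ∀ v, L v = fiberCoord p (⟨u.1, v⟩ : TangentBundle 𝓘(ℝ, E) M) :=
    fun v ↦ continuousLinearMapAt_eq_fiberCoord hu v
  have hLfr : ∀ i, L (e.localFrame b i u.1) = b i := fun i ↦ by
    rw [Trivialization.localFrame_apply_of_mem_baseSet _ _ hu]
    rw [Trivialization.basisAt, Module.Basis.map_apply, hL]
    exact (e.linearEquivAt ℝ u.1 hu).apply_symm_apply (b i)
  have hsum : ∀ᶠ q in 𝓝 u.1, s q = ∑ i, c i q • e.localFrame b i q := by
    filter_upwards [e.open_baseSet.mem_nhds hu] with q hq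
    refine ((e.basisAt b hq).sum_repr (s q)).symm.trans (Finset.sum_congr rfl fun i _ ↦ ?_)
    rw [Trivialization.localFrame_apply_of_mem_baseSet _ _ hq]
    rfl
  have hcd : ∀ i, MDiffAt (c i) u.1 := fun i ↦ (hc' i).mdifferentiableAt
  -- Expand s = ∑ cᵢ eᵢ in the frame and apply the Leibniz rule. In the trivialization the terms
  -- (dcᵢ) eᵢ add up to dD(x), which cancels the contribution of `extendDeriv`.
  have hnab : nabla s u.1 x
      = ∑ i, (c i u.1 • nabla (e.localFrame b i) u.1 x + d% (c i) u.1 x • e.localFrame b i u.1) := by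
    rw [← nabla.sum_smul_apply Finset.univ hcd hfr x]
    congr 1
    exact nabla.isCovariantDerivativeOnUniv.congr_of_eventuallyEq hs
      (MDifferentiableAt.sum_section fun i _ ↦ (hcd i).smul_section (hfr i)) univ_mem hsum
  have h1 : d% (fiberCoord (E := E) p) u (hLift nabla u x) = d% D u.1 x - L (nabla s u.1 x) := by
    change d% (fiberCoord (E := E) p) u (extendDeriv u x - vLift u (nabla s u.1 x)) = _
    rw [map_sub, mvfderiv_extendDeriv hd, mvfderiv_fiberCoord_vLift hu hd, hL]
  have hDu : D u.1 = fiberCoord p u := by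
    change fiberCoord p (⟨u.1, s u.1⟩ : TangentBundle 𝓘(ℝ, E) M) = _
    rw [hsu]
  rw [h1, hnab, map_sum]
  simp_rw [map_add, map_smul, hLfr, hL, hdc, Finset.sum_add_distrib]
  rw [b.sum_repr, ← hDu]
  abel

theorem contMDiffAt_hField [FiniteDimensional ℝ E]
    {nabla : CovariantDerivative 𝓘(ℝ, E) E (TangentSpace 𝓘(ℝ, E) : M → Type _)}
    (hsmooth : ∀ (X Y : Π x : M, TangentSpace 𝓘(ℝ, E) x) (x : M),
      CMDiffAt ∞ (T% X) x → CMDiffAt ∞ (T% Y) x → CMDiffAt ∞ (T% (fun y ↦ nabla Y y (X y))) x)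
    {X : Π x : M, TangentSpace 𝓘(ℝ, E) x} {u : TangentBundle 𝓘(ℝ, E) M}
    (hX : CMDiffAt ∞ (T% X) u.1) : CMDiffAt ∞ (T% (hField nabla X)) u := by
  have hπ := contMDiffAt_proj_tangentBundle u
  have hu := FiberBundle.mem_baseSet_trivializationAt' (F := E)
    (E := (TangentSpace 𝓘(ℝ, E) : M → Type _)) u.1
  refine contMDiffAt_vectorField_tangentBundle ?_ ?_
  · refine ((contMDiffAt_vectorField_iff.1 hX).comp u hπ).congr_of_eventuallyEq
      (.of_forall fun w ↦ ?_)
    change d% (extChartAt 𝓘(ℝ, E) u.1) w.1 (dProj w (hLift nabla w (X w.1))) = _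
    rw [dProj_hLift]
    rfl
  · let b := Module.finBasis ℝ E
    let e := trivializationAt E (TangentSpace 𝓘(ℝ, E)) u.1
    have hsum : CMDiffAt ∞ (fun w : TangentBundle 𝓘(ℝ, E) M ↦
        -∑ i, b.repr (fiberCoord u.1 w) i • fiberCoord u.1 (⟨w.1, nabla
          (e.localFrame b i) w.1 (X w.1)⟩ : TangentBundle 𝓘(ℝ, E) M)) u := by
      have h₁ : ∀ i, CMDiffAt ∞ (fun w : TangentBundle 𝓘(ℝ, E) M ↦
          b.repr (fiberCoord u.1 w) i) u := fun i ↦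
        ((b.coord i).toContinuousLinearMap.contMDiff.contMDiffAt).comp u (contMDiffAt_fiberCoord u)
      have h₂ : ∀ i, CMDiffAt ∞ (fun w : TangentBundle 𝓘(ℝ, E) M ↦
          fiberCoord u.1 (⟨w.1, nabla (e.localFrame b i) w.1 (X w.1)⟩ :
            TangentBundle 𝓘(ℝ, E) M)) u := fun i ↦
        ((contMDiffAt_section u.1).1 (hsmooth X (e.localFrame b i) u.1 hX
          (contMDiffAt_localFrame_of_mem (n := ∞) e b i hu))).comp u hπ
      exact (contMDiffAt_finsetSum fun i _ ↦ (h₁ i).smul (h₂ i)).neg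
    refine hsum.congr_of_eventuallyEq ?_
    filter_upwards [(contMDiffAt_fiberCoord u).eventually_mdifferentiableAt,
      hπ.continuousAt.eventually (e.open_baseSet.mem_nhds hu)] with w hw hw'
    exact mvfderiv_fiberCoord_hLift b nabla hw' hw _

end SmoothLifts

/-! ### The complete lift in terms of derivatives and projections. -/

noncomputable section CompleteLift

variable {E : Type*} [NormedAddCommGroup E] [NormedSpace ℝ E] [FiniteDimensional ℝ E]
  {M : Type*} [TopologicalSpace M] [ChartedSpace E M] [IsManifold 𝓘(ℝ, E) ∞ M]

section Parts

variable (g : Π x : M, TangentSpace 𝓘(ℝ, E) x →L[ℝ] TangentSpace 𝓘(ℝ, E) x →L[ℝ] ℝ)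
  (nabla : CovariantDerivative 𝓘(ℝ, E) E (TangentSpace 𝓘(ℝ, E) : M → Type _))
  (u : TangentBundle 𝓘(ℝ, E) M)

@[simp] theorem hPart_hLift (x : TangentSpace 𝓘(ℝ, E) u.1) : hPart nabla u (hLift nabla u x) = x :=
  congrArg Prod.fst (liftEquiv_symm_hLift nabla u x)

@[simp] theorem vPart_hLift (x : TangentSpace 𝓘(ℝ, E) u.1) : vPart nabla u (hLift nabla u x) = 0 :=
  congrArg Prod.snd (liftEquiv_symm_hLift nabla u x)

@[simp] theorem hPart_vLift (x : TangentSpace 𝓘(ℝ, E) u.1) : hPart nabla u (vLift u x) = 0 :=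
  congrArg Prod.fst (liftEquiv_symm_vLift nabla u x)

@[simp] theorem vPart_vLift (x : TangentSpace 𝓘(ℝ, E) u.1) : vPart nabla u (vLift u x) = x :=
  congrArg Prod.snd (liftEquiv_symm_vLift nabla u x)

theorem hLift_hPart_add_vLift_vPart (ξ : TangentSpace 𝓘(ℝ, E).tangent u) :
    hLift nabla u (hPart nabla u ξ) + vLift u (vPart nabla u ξ) = ξ :=
  (liftEquiv nabla u).apply_symm_apply ξ

theorem hPart_eq_dProj (ξ : TangentSpace 𝓘(ℝ, E).tangent u) : hPart nabla u ξ = dProj u ξ := by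
  conv_rhs => rw [← hLift_hPart_add_vLift_vPart nabla u ξ]
  rw [map_add, dProj_hLift, dProj_vLift, add_zero]

theorem completeLift_apply (ξ η : TangentSpace 𝓘(ℝ, E).tangent u) :
    completeLift g nabla u ξ η = g u.1 (hPart nabla u ξ) (vPart nabla u η)
      + g u.1 (vPart nabla u ξ) (hPart nabla u η) := rfl

theorem completeLift_hLift_right (ξ : TangentSpace 𝓘(ℝ, E).tangent u)
    (z : TangentSpace 𝓘(ℝ, E) u.1) :
    completeLift g nabla u ξ (hLift nabla u z) = g u.1 (vPart nabla u ξ) z := by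
  rw [completeLift_apply, hPart_hLift, vPart_hLift, map_zero, zero_add]

theorem completeLift_vLift_right (ξ : TangentSpace 𝓘(ℝ, E).tangent u)
    (z : TangentSpace 𝓘(ℝ, E) u.1) :
    completeLift g nabla u ξ (vLift u z) = g u.1 (hPart nabla u ξ) z := by
  rw [completeLift_apply, hPart_vLift, vPart_vLift, map_zero, add_zero]

end Parts

/-- Brackets of π-related fields are π-related: on a function f ∘ π the commutator of A and B is
that of X and Y on f, and such functions determine the projected vector. -/
theorem dProj_mlieBracket {A B : Π u : TangentBundle 𝓘(ℝ, E) M, TangentSpace 𝓘(ℝ, E).tangent u}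
    {X Y : Π x : M, TangentSpace 𝓘(ℝ, E) x} {u : TangentBundle 𝓘(ℝ, E) M}
    (hA : CMDiffAt ∞ (T% A) u) (hB : CMDiffAt ∞ (T% B) u)
    (hX : CMDiffAt ∞ (T% X) u.1) (hY : CMDiffAt ∞ (T% Y) u.1)
    (hAX : ∀ w, dProj w (A w) = X w.1) (hBY : ∀ w, dProj w (B w) = Y w.1) :
    dProj u (mlieBracket 𝓘(ℝ, E).tangent A B u) = mlieBracket 𝓘(ℝ, E) X Y u.1 := by
  have : CompleteSpace E := FiniteDimensional.complete ℝ E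
  refine eq_of_forall_mvfderiv_eq fun f hf ↦ ?_
  have hπ := contMDiffAt_proj_tangentBundle u
  have hfd := hπ.continuousAt.eventually hf.eventually_mdifferentiableAt
  have hX' := (hf.mvfderiv_vectorField hX).mdifferentiableAt (by simp)
  have hY' := (hf.mvfderiv_vectorField hY).mdifferentiableAt (by simp)
  have hπ' := hπ.mdifferentiableAt (by simp)
  have h := mvfderiv_mlieBracket (f := fun w : TangentBundle 𝓘(ℝ, E) M ↦ f w.1)
    (fX := fun w : TangentBundle 𝓘(ℝ, E) M ↦ d% f w.1 (X w.1))
    (fY := fun w : TangentBundle 𝓘(ℝ, E) M ↦ d% f w.1 (Y w.1)) hA hB (hf.comp u hπ)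
    (hfd.mono fun w hw ↦ by rw [mvfderiv_comp_proj hw, hAX])
    (hfd.mono fun w hw ↦ by rw [mvfderiv_comp_proj hw, hBY])
    (hX'.comp u hπ') (hY'.comp u hπ')
  rw [← mvfderiv_comp_proj (hf.mdifferentiableAt (by simp)), h, mvfderiv_comp_proj hX',
    mvfderiv_comp_proj hY', hAX, hBY,
    mvfderiv_mlieBracket hX hY hf (.of_forall fun _ ↦ rfl) (.of_forall fun _ ↦ rfl) hX' hY']

namespace AlmostNordenStructure

variable (S : AlmostNordenStructure E M)
  {nabla : CovariantDerivative 𝓘(ℝ, E) E (TangentSpace 𝓘(ℝ, E) : M → Type _)}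

theorem completeLift_symm (u : TangentBundle 𝓘(ℝ, E) M)
    (ξ η : TangentSpace 𝓘(ℝ, E).tangent u) :
    completeLift S.g nabla u ξ η = completeLift S.g nabla u η ξ := by
  rw [completeLift_apply, completeLift_apply, S.g_symm u.1 (hPart nabla u ξ),
    S.g_symm u.1 (vPart nabla u ξ), add_comm]

variable {u : TangentBundle 𝓘(ℝ, E) M}
  {X Y Z : Π x : M, TangentSpace 𝓘(ℝ, E) x}

/-- The derivative of g(Z, ·) along ξ is the vertical part paired with Z plus g(∇_{dπ ξ} Z, u).
Solving for the pairing reduces brackets of lifts to commutators acting on `flatFun`. -/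
theorem completeLift_hField_right (hnabla : IsLeviCivita S.g nabla) (hZ : MDiffAt (T% Z) u.1)
    (ξ : TangentSpace 𝓘(ℝ, E).tangent u) :
    completeLift S.g nabla u ξ (hField nabla Z u)
      = d% (flatFun S.g Z) u ξ - S.g u.1 (nabla Z u.1 (dProj u ξ)) u.2 := by
  rw [hField, completeLift_hLift_right, ← hPart_eq_dProj nabla]
  conv_rhs => rw [← hLift_hPart_add_vLift_vPart nabla u ξ]
  rw [map_add, S.mvfderiv_flatFun_hLift hnabla hZ, S.mvfderiv_flatFun_vLift hZ, map_add,
    hPart_hLift, hPart_vLift, add_zero, S.g_symm u.1 (Z u.1)]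
  ring

theorem completeLift_vField_right (ξ : TangentSpace 𝓘(ℝ, E).tangent u) :
    completeLift S.g nabla u ξ (vField Z u) = S.g u.1 (dProj u ξ) (Z u.1) := by
  rw [vField, completeLift_vLift_right, hPart_eq_dProj]

end AlmostNordenStructure

end CompleteLift

/-! ### Brackets of lifts, tested against lifts. -/

noncomputable section LiftBrackets

variable {E : Type*} [NormedAddCommGroup E] [NormedSpace ℝ E]
  {M : Type*} [TopologicalSpace M] [ChartedSpace E M] [IsManifold 𝓘(ℝ, E) ∞ M]

namespace AlmostNordenStructure

variable (S : AlmostNordenStructure E M)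
  {nabla : CovariantDerivative 𝓘(ℝ, E) E (TangentSpace 𝓘(ℝ, E) : M → Type _)}
  {u : TangentBundle 𝓘(ℝ, E) M} {X Y Z : Π x : M, TangentSpace 𝓘(ℝ, E) x}

theorem eventually_mvfderiv_flatFun_hField (hnabla : IsLeviCivita S.g nabla)
    (X : Π x : M, TangentSpace 𝓘(ℝ, E) x) (hZ : CMDiffAt ∞ (T% Z) u.1) :
    ∀ᶠ w in 𝓝 u, d% (flatFun S.g Z) w (hField nabla X w)
      = flatFun S.g (fun y ↦ nabla Z y (X y)) w := by
  filter_upwards [(contMDiffAt_proj_tangentBundle u).continuousAt.eventually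
    hZ.eventually_mdifferentiableAt] with w hw
  exact S.mvfderiv_flatFun_hLift hnabla hw _

theorem eventually_mvfderiv_flatFun_vField
    (X : Π x : M, TangentSpace 𝓘(ℝ, E) x) (hZ : CMDiffAt ∞ (T% Z) u.1) :
    ∀ᶠ w in 𝓝 u, d% (flatFun S.g Z) w (vField X w) = S.g w.1 (Z w.1) (X w.1) := by
  filter_upwards [(contMDiffAt_proj_tangentBundle u).continuousAt.eventually
    hZ.eventually_mdifferentiableAt] with w hw
  exact S.mvfderiv_flatFun_vLift hw _

theorem dProj_hField (w : TangentBundle 𝓘(ℝ, E) M) : dProj w (hField nabla X w) = X w.1 :=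
  dProj_hLift nabla w _

theorem dProj_vField (w : TangentBundle 𝓘(ℝ, E) M) : dProj w (vField X w) = 0 :=
  dProj_vLift w _

variable [FiniteDimensional ℝ E]

/-- X^H and Y^H act on g(Z, ·) by covariantly differentiating Z, so their commutator gives the
second-order terms of R(X, Y)Z. The term ∇_[X,Y] Z is the correction in `completeLift_hField_right`.
-/
theorem completeLift_mlieBracket_hField_hField_hField (hnabla : IsLeviCivita S.g nabla)
    (hX : CMDiffAt ∞ (T% X) u.1) (hY : CMDiffAt ∞ (T% Y) u.1) (hZ : CMDiffAt ∞ (T% Z) u.1) :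
    completeLift S.g nabla u
        (mlieBracket 𝓘(ℝ, E).tangent (hField nabla X) (hField nabla Y) u) (hField nabla Z u)
      = S.g u.1 (curvatureOp nabla X Y Z u.1) u.2 := by
  have : CompleteSpace E := FiniteDimensional.complete ℝ E
  have hXZ := hnabla.smooth X Z u.1 hX hZ
  have hYZ := hnabla.smooth Y Z u.1 hY hZ
  have hXH := contMDiffAt_hField hnabla.smooth hX
  have hYH := contMDiffAt_hField hnabla.smooth hY
  rw [S.completeLift_hField_right hnabla (hZ.mdifferentiableAt (by simp)),
    mvfderiv_mlieBracket hXH hYH (S.contMDiffAt_flatFun hZ)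
      (S.eventually_mvfderiv_flatFun_hField hnabla X hZ)
      (S.eventually_mvfderiv_flatFun_hField hnabla Y hZ)
      ((S.contMDiffAt_flatFun hXZ).mdifferentiableAt (by simp))
      ((S.contMDiffAt_flatFun hYZ).mdifferentiableAt (by simp)),
    (S.eventually_mvfderiv_flatFun_hField hnabla X hYZ).self_of_nhds,
    (S.eventually_mvfderiv_flatFun_hField hnabla Y hXZ).self_of_nhds,
    dProj_mlieBracket hXH hYH hX hY dProj_hField dProj_hField]
  simp only [curvatureOp, flatFun, map_sub, _root_.sub_apply]

theorem completeLift_mlieBracket_hField_hField_vField (hnabla : IsLeviCivita S.g nabla)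
    (hX : CMDiffAt ∞ (T% X) u.1) (hY : CMDiffAt ∞ (T% Y) u.1)
    (Z : Π x : M, TangentSpace 𝓘(ℝ, E) x) :
    completeLift S.g nabla u
        (mlieBracket 𝓘(ℝ, E).tangent (hField nabla X) (hField nabla Y) u) (vField Z u)
      = S.g u.1 (mlieBracket 𝓘(ℝ, E) X Y u.1) (Z u.1) := by
  rw [completeLift_vField_right, dProj_mlieBracket (contMDiffAt_hField hnabla.smooth hX)
    (contMDiffAt_hField hnabla.smooth hY) hX hY dProj_hField dProj_hField]

theorem dProj_mlieBracket_hField_vField (hnabla : IsLeviCivita S.g nabla)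
    (hX : CMDiffAt ∞ (T% X) u.1) (hY : CMDiffAt ∞ (T% Y) u.1) :
    dProj u (mlieBracket 𝓘(ℝ, E).tangent (hField nabla X) (vField Y) u) = 0 := by
  -- A vertical lift is π-related to the zero field.
  rw [dProj_mlieBracket (Y := 0) (contMDiffAt_hField hnabla.smooth hX) (contMDiffAt_vField hY) hX
    (contMDiffAt_zeroSection ℝ _) dProj_hField dProj_vField, mlieBracket_zero_right]
  rfl

theorem dProj_mlieBracket_vField_vField
    (hX : CMDiffAt ∞ (T% X) u.1) (hY : CMDiffAt ∞ (T% Y) u.1) :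
    dProj u (mlieBracket 𝓘(ℝ, E).tangent (vField X) (vField Y) u) = 0 := by
  rw [dProj_mlieBracket (X := 0) (Y := 0) (contMDiffAt_vField hX) (contMDiffAt_vField hY)
    (contMDiffAt_zeroSection ℝ _) (contMDiffAt_zeroSection ℝ _) dProj_vField dProj_vField,
    mlieBracket_zero_right]
  rfl

/-- The commutator on g(Z, ·) is X g(Z, Y) - g(∇_X Z, Y), which is g(Z, ∇_X Y) by metric
compatibility. -/
theorem completeLift_mlieBracket_hField_vField_hField (hnabla : IsLeviCivita S.g nabla)
    (hX : CMDiffAt ∞ (T% X) u.1) (hY : CMDiffAt ∞ (T% Y) u.1) (hZ : CMDiffAt ∞ (T% Z) u.1) :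
    completeLift S.g nabla u
        (mlieBracket 𝓘(ℝ, E).tangent (hField nabla X) (vField Y) u) (hField nabla Z u)
      = S.g u.1 (nabla Y u.1 (X u.1)) (Z u.1) := by
  have : CompleteSpace E := FiniteDimensional.complete ℝ E
  have hXZ := hnabla.smooth X Z u.1 hX hZ
  have hπ := contMDiffAt_proj_tangentBundle u
  have hZY : MDiffAt (fun y ↦ S.g y (Z y) (Y y)) u.1 :=
    (S.contMDiffAt_g_apply hZ hY).mdifferentiableAt (by simp)
  have hZd := hZ.mdifferentiableAt (n := ∞) (by simp)
  have hYd := hY.mdifferentiableAt (n := ∞) (by simp)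
  rw [S.completeLift_hField_right hnabla hZd,
    mvfderiv_mlieBracket (contMDiffAt_hField hnabla.smooth hX) (contMDiffAt_vField hY)
      (S.contMDiffAt_flatFun hZ)
      (S.eventually_mvfderiv_flatFun_hField hnabla X hZ)
      (S.eventually_mvfderiv_flatFun_vField Y hZ)
      ((S.contMDiffAt_flatFun hXZ).mdifferentiableAt (by simp))
      (hZY.comp u (hπ.mdifferentiableAt (by simp))),
    (S.eventually_mvfderiv_flatFun_vField Y hXZ).self_of_nhds,
    mvfderiv_comp_proj (f := fun y ↦ S.g y (Z y) (Y y)) hZY, dProj_hField,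
    hnabla.metric X Z Y u.1 hZd hYd, S.dProj_mlieBracket_hField_vField hnabla hX hY, map_zero,
    map_zero, S.g_symm u.1 (Z u.1)]
  simp

theorem completeLift_mlieBracket_hField_vField_vField (hnabla : IsLeviCivita S.g nabla)
    (hX : CMDiffAt ∞ (T% X) u.1) (hY : CMDiffAt ∞ (T% Y) u.1)
    (Z : Π x : M, TangentSpace 𝓘(ℝ, E) x) :
    completeLift S.g nabla u
        (mlieBracket 𝓘(ℝ, E).tangent (hField nabla X) (vField Y) u) (vField Z u) = 0 := by
  rw [completeLift_vField_right, S.dProj_mlieBracket_hField_vField hnabla hX hY, map_zero]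
  rfl

/-- One vertical derivative turns g(Z, ·) into a function pulled back from M, and a second one kills
it. -/
theorem completeLift_mlieBracket_vField_vField_hField (hnabla : IsLeviCivita S.g nabla)
    (hX : CMDiffAt ∞ (T% X) u.1) (hY : CMDiffAt ∞ (T% Y) u.1) (hZ : CMDiffAt ∞ (T% Z) u.1) :
    completeLift S.g nabla u
        (mlieBracket 𝓘(ℝ, E).tangent (vField X) (vField Y) u) (hField nabla Z u) = 0 := by
  have : CompleteSpace E := FiniteDimensional.complete ℝ E
  have hπ := (contMDiffAt_proj_tangentBundle u).mdifferentiableAt (n := ∞) (by simp)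
  have hZY : MDiffAt (fun y ↦ S.g y (Z y) (Y y)) u.1 :=
    (S.contMDiffAt_g_apply hZ hY).mdifferentiableAt (by simp)
  have hZX : MDiffAt (fun y ↦ S.g y (Z y) (X y)) u.1 :=
    (S.contMDiffAt_g_apply hZ hX).mdifferentiableAt (by simp)
  rw [S.completeLift_hField_right hnabla (hZ.mdifferentiableAt (by simp)),
    mvfderiv_mlieBracket (contMDiffAt_vField hX) (contMDiffAt_vField hY)
      (S.contMDiffAt_flatFun hZ)
      (S.eventually_mvfderiv_flatFun_vField X hZ)
      (S.eventually_mvfderiv_flatFun_vField Y hZ)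
      (hZX.comp u hπ) (hZY.comp u hπ),
    mvfderiv_comp_proj (f := fun y ↦ S.g y (Z y) (Y y)) hZY,
    mvfderiv_comp_proj (f := fun y ↦ S.g y (Z y) (X y)) hZX, dProj_vField, dProj_vField,
    dProj_mlieBracket_vField_vField hX hY]
  simp

theorem completeLift_mlieBracket_vField_vField_vField
    (hX : CMDiffAt ∞ (T% X) u.1) (hY : CMDiffAt ∞ (T% Y) u.1)
    (Z : Π x : M, TangentSpace 𝓘(ℝ, E) x) :
    completeLift S.g nabla u
        (mlieBracket 𝓘(ℝ, E).tangent (vField X) (vField Y) u) (vField Z u) = 0 := by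
  rw [completeLift_vField_right, dProj_mlieBracket_vField_vField hX hY, map_zero]
  rfl

end AlmostNordenStructure

end LiftBrackets

/-! ### Koszul's formula and the first Bianchi identity. -/

section LeviCivitaIdentities

variable {E : Type*} [NormedAddCommGroup E] [NormedSpace ℝ E]
  {H : Type*} [TopologicalSpace H] {I : ModelWithCorners ℝ E H}
  {M : Type*} [TopologicalSpace M] [ChartedSpace H M] [IsManifold I ∞ M]
  {g : Π x : M, TangentSpace I x →L[ℝ] TangentSpace I x →L[ℝ] ℝ}
  {cov : CovariantDerivative I E (TangentSpace I : M → Type _)}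

theorem CovariantDerivative.neg_apply (cov : CovariantDerivative I E (TangentSpace I : M → Type _))
    {Y : Π x : M, TangentSpace I x} {x : M} (hY : MDiffAt (T% Y) x) (v : TangentSpace I x) :
    cov (fun y ↦ -Y y) x v = -cov Y x v := by
  have h : (fun y ↦ -Y y) = (-1 : ℝ) • Y := by
    funext y
    simp
  rw [h, cov.isCovariantDerivativeOnUniv.smul_const (-1 : ℝ) hY]
  simp

theorem CovariantDerivative.sub_apply (cov : CovariantDerivative I E (TangentSpace I : M → Type _))
    {Y Z : Π x : M, TangentSpace I x} {x : M} (hY : MDiffAt (T% Y) x) (hZ : MDiffAt (T% Z) x)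
    (v : TangentSpace I x) :
    cov (fun y ↦ Y y - Z y) x v = cov Y x v - cov Z x v := by
  have h : (fun y ↦ Y y - Z y) = Y + fun y ↦ -Z y := by
    funext y
    exact sub_eq_add_neg _ _
  have hZ' : MDiffAt (T% (fun y ↦ -Z y)) x := mdifferentiableAt_neg_section hZ
  rw [h, cov.isCovariantDerivativeOnUniv.add hY hZ',
    _root_.add_apply, cov.neg_apply hZ, sub_eq_add_neg]

namespace IsLeviCivita

/-- Koszul's formula. -/
theorem koszul (hcov : IsLeviCivita g cov) (hg : ∀ x v w, g x v w = g x w v)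
    {A B C : Π x : M, TangentSpace I x} {x : M}
    (hA : MDiffAt (T% A) x) (hB : MDiffAt (T% B) x) (hC : MDiffAt (T% C) x) :
    2 * g x (cov B x (A x)) (C x)
      = d% (fun y ↦ g y (B y) (C y)) x (A x) + d% (fun y ↦ g y (A y) (C y)) x (B x)
        - d% (fun y ↦ g y (A y) (B y)) x (C x) + g x (mlieBracket I A B x) (C x)
        - g x (mlieBracket I A C x) (B x) - g x (mlieBracket I B C x) (A x) := by
  rw [hcov.metric A B C x hB hC, hcov.metric B A C x hA hC, hcov.metric C A B x hA hB,
    ← hcov.torsion_free A B x hA hB, ← hcov.torsion_free A C x hA hC,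
    ← hcov.torsion_free B C x hB hC]
  simp only [map_sub, _root_.sub_apply]
  rw [hg x (B x) (cov C x (A x)), hg x (A x) (cov C x (B x)), hg x (A x) (cov B x (C x))]
  ring

end IsLeviCivita

theorem curvatureForm_swap_left (X Y Z W : Π x : M, TangentSpace I x) (x : M) :
    curvatureForm g cov X Y Z W x = -curvatureForm g cov Y X Z W x := by
  simp only [curvatureForm, curvatureOp]
  rw [mlieBracket_swap_apply (V := X)]
  simp only [map_sub, map_neg, _root_.sub_apply, _root_.neg_apply]
  ring

namespace IsLeviCivita

/-- Torsion-freeness used twice gives ∇_A(∇_B C - ∇_C B) - ∇_[B,C] A = [A, [B, C]]. The cyclic sum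
of the left side is the cyclic sum of curvatures, and that of the right side vanishes by Jacobi. -/
theorem bianchi [CompleteSpace E] (hcov : IsLeviCivita g cov) {X Y Z : Π x : M, TangentSpace I x}
    (W : Π x : M, TangentSpace I x) {x : M}
    (hX : CMDiffAt ∞ (T% X) x) (hY : CMDiffAt ∞ (T% Y) x) (hZ : CMDiffAt ∞ (T% Z) x) :
    curvatureForm g cov X Y Z W x + curvatureForm g cov Y Z X W x
      + curvatureForm g cov Z X Y W x = 0 := by
  have : IsManifold I (minSmoothness ℝ 3) M := by
    rw [minSmoothness_of_isRCLikeNormedField]; infer_instance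
  have : IsManifold I (((⊤ : ℕ∞) : ℕ∞ω) + 1) M := inferInstanceAs (IsManifold I ∞ M)
  have h2 : minSmoothness ℝ 2 ≤ ∞ := by
    rw [minSmoothness_of_isRCLikeNormedField]; exact ENat.LEInfty.out
  have hmin : minSmoothness ℝ (((1 : ℕ∞) : ℕ∞ω) + 1) ≤ ((⊤ : ℕ∞) : ℕ∞ω) := by
    rw [minSmoothness_of_isRCLikeNormedField]; exact_mod_cast (le_top : (1 + 1 : ℕ∞) ≤ ⊤)
  have key : ∀ {A B C : Π x : M, TangentSpace I x}, CMDiffAt ∞ (T% A) x → CMDiffAt ∞ (T% B) x →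
      CMDiffAt ∞ (T% C) x →
      cov (fun y ↦ cov C y (B y)) x (A x) - cov (fun y ↦ cov B y (C y)) x (A x)
        - cov A x (mlieBracket I B C x) = mlieBracket I A (mlieBracket I B C) x := by
    intro A B C hA hB hC
    have hBC : MDiffAt (T% (mlieBracket I B C)) x :=
      (ContMDiffAt.mlieBracket_vectorField (m := 1) (n := ⊤) hB hC hmin).mdifferentiableAt
        one_ne_zero
    have h1 := (hcov.smooth B C x hB hC).mdifferentiableAt (n := ∞) (by simp)
    have h2 := (hcov.smooth C B x hC hB).mdifferentiableAt (n := ∞) (by simp)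
    -- Torsion-freeness holds on a neighbourhood, so it may be differentiated.
    have e : cov (fun y ↦ cov C y (B y) - cov B y (C y)) x = cov (mlieBracket I B C) x :=
      cov.isCovariantDerivativeOnUniv.congr_of_eventuallyEq (mdifferentiableAt_sub_section h1 h2)
        hBC univ_mem (by
          filter_upwards [hB.eventually_mdifferentiableAt, hC.eventually_mdifferentiableAt]
            with y hy hy' using hcov.torsion_free B C y hy hy')
    rw [← cov.sub_apply h1 h2, e, hcov.torsion_free A _ x (hA.mdifferentiableAt (by simp)) hBC]
  have jac := leibniz_identity_mlieBracket_apply (hX.of_le h2) (hY.of_le h2) (hZ.of_le h2)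
  have e1 := key hX hY hZ
  have e2 := key hY hZ hX
  have e3 := key hZ hX hY
  -- Two swaps bring the Leibniz form of the Jacobi identity into cyclic form.
  have hs : mlieBracket I (mlieBracket I X Y) Z x = -mlieBracket I Z (mlieBracket I X Y) x :=
    mlieBracket_swap_apply
  have hs' : mlieBracket I Y (mlieBracket I X Z) x = -mlieBracket I Y (mlieBracket I Z X) x := by
    rw [mlieBracket_swap (V := X)]
    have := mlieBracket_const_smul_right (I := I) (V := Y) (W := mlieBracket I Z X) (x := x)
      (c := (-1 : ℝ)) ((ContMDiffAt.mlieBracket_vectorField (m := 1) (n := ⊤) hZ hX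
        hmin).mdifferentiableAt one_ne_zero)
    simpa using this
  rw [hs, hs', ← e1, ← e2, ← e3] at jac
  have hsum : curvatureOp cov X Y Z x + curvatureOp cov Y Z X x + curvatureOp cov Z X Y x = 0 := by
    rw [← sub_eq_zero] at jac
    rw [← jac]
    simp only [curvatureOp]
    abel
  have := congrArg (fun v ↦ g x v (W x)) hsum
  simpa [curvatureForm] using this

end IsLeviCivita

end LeviCivitaIdentities

/-! ### Skew symmetry and pair symmetry of the curvature tensor. -/

section CurvatureSymmetries

variable {E : Type*} [NormedAddCommGroup E] [NormedSpace ℝ E] [CompleteSpace E]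
  {M : Type*} [TopologicalSpace M] [ChartedSpace E M] [IsManifold 𝓘(ℝ, E) ∞ M]
  (S : AlmostNordenStructure E M)
  {nabla : CovariantDerivative 𝓘(ℝ, E) E (TangentSpace 𝓘(ℝ, E) : M → Type _)}
  {X Y Z W : Π x : M, TangentSpace 𝓘(ℝ, E) x} {x : M}

namespace AlmostNordenStructure

/-- Compute [X, Y] g(Z, W) directly and as a commutator, using metric compatibility. The mixed terms
g(∇_X Z, ∇_Y W) and g(∇_Y Z, ∇_X W) cancel, leaving R(X, Y, Z, W) + R(X, Y, W, Z) = 0. -/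
theorem curvatureForm_swap_right (hnabla : IsLeviCivita S.g nabla)
    (hX : CMDiffAt ∞ (T% X) x) (hY : CMDiffAt ∞ (T% Y) x)
    (hZ : CMDiffAt ∞ (T% Z) x) (hW : CMDiffAt ∞ (T% W) x) :
    curvatureForm S.g nabla X Y Z W x = -curvatureForm S.g nabla X Y W Z x := by
  have hZd := hZ.mdifferentiableAt (n := ∞) (by simp)
  have hWd := hW.mdifferentiableAt (n := ∞) (by simp)
  have hder : ∀ A : Π x : M, TangentSpace 𝓘(ℝ, E) x, ∀ᶠ y in 𝓝 x,
      d% (fun y ↦ S.g y (Z y) (W y)) y (A y)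
        = S.g y (nabla Z y (A y)) (W y) + S.g y (Z y) (nabla W y (A y)) := fun A ↦ by
    filter_upwards [hZ.eventually_mdifferentiableAt, hW.eventually_mdifferentiableAt] with y hy hy'
    exact hnabla.metric A Z W y hy hy'
  have hd : ∀ {A B : Π x : M, TangentSpace 𝓘(ℝ, E) x}, CMDiffAt ∞ (T% A) x → CMDiffAt ∞ (T% B) x →
      MDiffAt (fun y ↦ S.g y (A y) (B y)) x := fun hA hB ↦
    (S.contMDiffAt_g_apply hA hB).mdifferentiableAt (by simp)
  have hder2 : ∀ {A : Π x : M, TangentSpace 𝓘(ℝ, E) x}, CMDiffAt ∞ (T% A) x →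
      ∀ B : Π x : M, TangentSpace 𝓘(ℝ, E) x,
      d% (fun y ↦ S.g y (nabla Z y (A y)) (W y) + S.g y (Z y) (nabla W y (A y))) x (B x)
        = S.g x (nabla (fun y ↦ nabla Z y (A y)) x (B x)) (W x)
          + S.g x (nabla Z x (A x)) (nabla W x (B x))
          + (S.g x (nabla Z x (B x)) (nabla W x (A x))
          + S.g x (Z x) (nabla (fun y ↦ nabla W y (A y)) x (B x))) := fun {A} hA B ↦ by
    have hAZ := hnabla.smooth A Z x hA hZ
    have hAW := hnabla.smooth A W x hA hW
    have h1 := hnabla.metric B (fun y ↦ nabla Z y (A y)) W x (hAZ.mdifferentiableAt (by simp)) hWd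
    have h2 := hnabla.metric B Z (fun y ↦ nabla W y (A y)) x hZd (hAW.mdifferentiableAt (by simp))
    rw [mvfderiv_fun_add (hd hAZ hW) (hd hZ hAW), _root_.add_apply, h1, h2]
  have h := mvfderiv_mlieBracket hX hY (S.contMDiffAt_g_apply hZ hW) (hder X) (hder Y)
    ((hd (hnabla.smooth X Z x hX hZ) hW).add (hd hZ (hnabla.smooth X W x hX hW)))
    ((hd (hnabla.smooth Y Z x hY hZ) hW).add (hd hZ (hnabla.smooth Y W x hY hW)))
  rw [hder2 hX, hder2 hY, (hder (mlieBracket 𝓘(ℝ, E) X Y)).self_of_nhds] at h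
  simp only [curvatureForm, curvatureOp, map_sub, _root_.sub_apply]
  rw [S.g_symm x (Z x), S.g_symm x (Z x), S.g_symm x (Z x)] at h
  linarith

/-- The classical octahedron argument: a linear combination of four Bianchi identities, with skew
symmetry in each pair of arguments. -/
theorem curvatureForm_pair_symm (hnabla : IsLeviCivita S.g nabla)
    (hX : CMDiffAt ∞ (T% X) x) (hY : CMDiffAt ∞ (T% Y) x)
    (hZ : CMDiffAt ∞ (T% Z) x) (hW : CMDiffAt ∞ (T% W) x) :
    curvatureForm S.g nabla X Y Z W x = curvatureForm S.g nabla Z W X Y x := by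
  have b1 := hnabla.bianchi W hX hY hZ
  have b2 := hnabla.bianchi X hY hZ hW
  have b3 := hnabla.bianchi Y hZ hW hX
  have b4 := hnabla.bianchi Z hW hX hY
  have s1 := S.curvatureForm_swap_right hnabla hX hY hZ hW
  have s2 := S.curvatureForm_swap_right hnabla hY hZ hX hW
  have s3 := S.curvatureForm_swap_right hnabla hZ hX hY hW
  have s4 := S.curvatureForm_swap_right hnabla hZ hW hY hX
  have s5 := S.curvatureForm_swap_right hnabla hW hY hZ hX
  have s6 := S.curvatureForm_swap_right hnabla hW hX hZ hY
  have l1 := curvatureForm_swap_left (g := S.g) (cov := nabla) X Z Y W x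
  have l2 := curvatureForm_swap_left (g := S.g) (cov := nabla) X Z W Y x
  have l3 := curvatureForm_swap_left (g := S.g) (cov := nabla) Y W X Z x
  have l4 := curvatureForm_swap_left (g := S.g) (cov := nabla) Y W Z X x
  linarith

end AlmostNordenStructure

end CurvatureSymmetries

/-! ### The Levi-Civita connection of the complete lift on lifted fields. -/

noncomputable section CompleteLiftLeviCivita

variable {E : Type*} [NormedAddCommGroup E] [NormedSpace ℝ E] [FiniteDimensional ℝ E]
  {M : Type*} [TopologicalSpace M] [ChartedSpace E M] [IsManifold 𝓘(ℝ, E) ∞ M]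

section LiftedTensors

variable (g : Π x : M, TangentSpace 𝓘(ℝ, E) x →L[ℝ] TangentSpace 𝓘(ℝ, E) x →L[ℝ] ℝ)
  (J : Π x : M, TangentSpace 𝓘(ℝ, E) x →L[ℝ] TangentSpace 𝓘(ℝ, E) x)
  (nabla : CovariantDerivative 𝓘(ℝ, E) E (TangentSpace 𝓘(ℝ, E) : M → Type _))
  (X Y : Π x : M, TangentSpace 𝓘(ℝ, E) x) (u : TangentBundle 𝓘(ℝ, E) M)

theorem completeLift_hField_hField :
    completeLift g nabla u (hField nabla X u) (hField nabla Y u) = 0 := by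
  rw [hField, hField, completeLift_hLift_right, vPart_hLift, map_zero]
  rfl

theorem completeLift_hField_vField :
    completeLift g nabla u (hField nabla X u) (vField Y u) = g u.1 (X u.1) (Y u.1) := by
  rw [hField, vField, completeLift_vLift_right, hPart_hLift]

theorem completeLift_vField_hField :
    completeLift g nabla u (vField X u) (hField nabla Y u) = g u.1 (X u.1) (Y u.1) := by
  rw [hField, vField, completeLift_hLift_right, vPart_vLift]

theorem completeLift_vField_vField :
    completeLift g nabla u (vField X u) (vField Y u) = 0 := by
  rw [vField, vField, completeLift_vLift_right, hPart_vLift, map_zero]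
  rfl

theorem J1_apply (ξ : TangentSpace 𝓘(ℝ, E).tangent u) : J1 nabla J u ξ
    = vLift u (J u.1 (vPart nabla u ξ)) - hLift nabla u (J u.1 (hPart nabla u ξ)) := rfl

theorem J2_apply (ξ : TangentSpace 𝓘(ℝ, E).tangent u) : J2 nabla u ξ
    = vLift u (hPart nabla u ξ) - hLift nabla u (vPart nabla u ξ) := rfl

theorem J3_apply (ξ : TangentSpace 𝓘(ℝ, E).tangent u) : J3 nabla J u ξ
    = vLift u (J u.1 (hPart nabla u ξ)) + hLift nabla u (J u.1 (vPart nabla u ξ)) := rfl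

theorem J1_hField : (fun u ↦ J1 nabla J u (hField nabla X u))
    = fun u ↦ -hField nabla (fun x ↦ J x (X x)) u := by
  funext u
  simp [hField, J1_apply]

theorem J1_vField : (fun u ↦ J1 nabla J u (vField X u)) = vField (fun x ↦ J x (X x)) := by
  funext u
  simp [vField, J1_apply]

theorem J2_hField : (fun u ↦ J2 nabla u (hField nabla X u)) = vField X := by
  funext u
  simp [hField, vField, J2_apply]

theorem J2_vField : (fun u ↦ J2 nabla u (vField X u)) = fun u ↦ -hField nabla X u := by
  funext u
  simp [hField, vField, J2_apply]

theorem J3_hField : (fun u ↦ J3 nabla J u (hField nabla X u)) = vField (fun x ↦ J x (X x)) := by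
  funext u
  simp [hField, vField, J3_apply]

theorem J3_vField : (fun u ↦ J3 nabla J u (vField X u))
    = hField nabla (fun x ↦ J x (X x)) := by
  funext u
  simp [hField, vField, J3_apply]

end LiftedTensors

namespace AlmostNordenStructure

variable (S : AlmostNordenStructure E M)

section Adjoints

variable (nabla : CovariantDerivative 𝓘(ℝ, E) E (TangentSpace 𝓘(ℝ, E) : M → Type _))
  (Z : Π x : M, TangentSpace 𝓘(ℝ, E) x) (u : TangentBundle 𝓘(ℝ, E) M)
  (ξ : TangentSpace 𝓘(ℝ, E).tangent u)

/-- This and the next five lemmas express that J₁ is skew-adjoint for ĝ and that J₂, J₃ are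
self-adjoint. -/
theorem completeLift_J1_hField : completeLift S.g nabla u (J1 nabla S.J u ξ) (hField nabla Z u)
    = completeLift S.g nabla u ξ (hField nabla (fun x ↦ S.J x (Z x)) u) := by
  simp [hField, completeLift_hLift_right, J1_apply, S.g_J_left]

theorem completeLift_J1_vField : completeLift S.g nabla u (J1 nabla S.J u ξ) (vField Z u)
    = -completeLift S.g nabla u ξ (vField (fun x ↦ S.J x (Z x)) u) := by
  simp [vField, completeLift_vLift_right, J1_apply, S.g_J_left]

theorem completeLift_J2_hField : completeLift S.g nabla u (J2 nabla u ξ) (hField nabla Z u)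
    = completeLift S.g nabla u ξ (vField Z u) := by
  simp [hField, vField, completeLift_hLift_right, completeLift_vLift_right, J2_apply]

theorem completeLift_J2_vField : completeLift S.g nabla u (J2 nabla u ξ) (vField Z u)
    = -completeLift S.g nabla u ξ (hField nabla Z u) := by
  simp [hField, vField, completeLift_hLift_right, completeLift_vLift_right, J2_apply]

theorem completeLift_J3_hField : completeLift S.g nabla u (J3 nabla S.J u ξ) (hField nabla Z u)
    = completeLift S.g nabla u ξ (vField (fun x ↦ S.J x (Z x)) u) := by
  simp [hField, vField, completeLift_hLift_right, completeLift_vLift_right, J3_apply, S.g_J_left]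

theorem completeLift_J3_vField : completeLift S.g nabla u (J3 nabla S.J u ξ) (vField Z u)
    = completeLift S.g nabla u ξ (hField nabla (fun x ↦ S.J x (Z x)) u) := by
  simp [hField, vField, completeLift_hLift_right, completeLift_vLift_right, J3_apply, S.g_J_left]

end Adjoints

variable {nabla : CovariantDerivative 𝓘(ℝ, E) E (TangentSpace 𝓘(ℝ, E) : M → Type _)}
  {nablaHat : CovariantDerivative 𝓘(ℝ, E).tangent (E × E)
      (TangentSpace 𝓘(ℝ, E).tangent : TangentBundle 𝓘(ℝ, E) M → Type _)}
  {u : TangentBundle 𝓘(ℝ, E) M} {U X Y Z : Π x : M, TangentSpace 𝓘(ℝ, E) x}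

theorem mdifferentiableAt_hField (hnabla : IsLeviCivita S.g nabla)
    (hX : CMDiffAt ∞ (T% X) u.1) : MDiffAt (T% (hField nabla X)) u :=
  (contMDiffAt_hField hnabla.smooth hX).mdifferentiableAt (by simp)

theorem mvfderiv_completeLift_vField_left (nabla : CovariantDerivative 𝓘(ℝ, E) E
      (TangentSpace 𝓘(ℝ, E) : M → Type _)) (ξ : TangentSpace 𝓘(ℝ, E).tangent u)
    (hX : CMDiffAt ∞ (T% X) u.1) (hY : CMDiffAt ∞ (T% Y) u.1) :
    d% (fun w ↦ completeLift S.g nabla w (vField X w) (hField nabla Y w)) u ξ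
      = d% (fun y ↦ S.g y (X y) (Y y)) u.1 (dProj u ξ) := by
  simp_rw [completeLift_vField_hField]
  exact mvfderiv_comp_proj (f := fun y ↦ S.g y (X y) (Y y))
    ((S.contMDiffAt_g_apply hX hY).mdifferentiableAt (by simp)) ξ

theorem mvfderiv_completeLift_vField_right (nabla : CovariantDerivative 𝓘(ℝ, E) E
      (TangentSpace 𝓘(ℝ, E) : M → Type _)) (ξ : TangentSpace 𝓘(ℝ, E).tangent u)
    (hX : CMDiffAt ∞ (T% X) u.1) (hY : CMDiffAt ∞ (T% Y) u.1) :
    d% (fun w ↦ completeLift S.g nabla w (hField nabla X w) (vField Y w)) u ξ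
      = d% (fun y ↦ S.g y (X y) (Y y)) u.1 (dProj u ξ) := by
  simp_rw [completeLift_hField_vField]
  exact mvfderiv_comp_proj (f := fun y ↦ S.g y (X y) (Y y))
    ((S.contMDiffAt_g_apply hX hY).mdifferentiableAt (by simp)) ξ

theorem mvfderiv_completeLift_hField_hField (nabla : CovariantDerivative 𝓘(ℝ, E) E
      (TangentSpace 𝓘(ℝ, E) : M → Type _)) (X Y : Π x : M, TangentSpace 𝓘(ℝ, E) x)
    (ξ : TangentSpace 𝓘(ℝ, E).tangent u) :
    d% (fun w ↦ completeLift S.g nabla w (hField nabla X w) (hField nabla Y w)) u ξ = 0 := by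
  simp_rw [completeLift_hField_hField, mvfderiv_const]
  rfl

theorem mvfderiv_completeLift_vField_vField (nabla : CovariantDerivative 𝓘(ℝ, E) E
      (TangentSpace 𝓘(ℝ, E) : M → Type _)) (X Y : Π x : M, TangentSpace 𝓘(ℝ, E) x)
    (ξ : TangentSpace 𝓘(ℝ, E).tangent u) :
    d% (fun w ↦ completeLift S.g nabla w (vField X w) (vField Y w)) u ξ = 0 := by
  simp_rw [completeLift_vField_vField, mvfderiv_const]
  rfl

/-- The metric terms of Koszul's formula vanish, leaving R(X, Y, Z, u) - R(X, Z, Y, u) - R(Y, Z, X,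
u). Bianchi reduces this to -2R(Y, Z, X, u), which equals 2R(u, X, Y, Z). The field U serves to
write the vector u as an argument of R. -/
theorem completeLift_nablaHat_hField_hField_hField (hnabla : IsLeviCivita S.g nabla)
    (hhat : IsLeviCivita (completeLift S.g nabla) nablaHat)
    (hU : CMDiffAt ∞ (T% U) u.1) (hX : CMDiffAt ∞ (T% X) u.1)
    (hY : CMDiffAt ∞ (T% Y) u.1) (hZ : CMDiffAt ∞ (T% Z) u.1) (hUu : U u.1 = u.2) :
    completeLift S.g nabla u (nablaHat (hField nabla Y) u (hField nabla X u)) (hField nabla Z u)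
      = curvatureForm S.g nabla U X Y Z u.1 := by
  have : CompleteSpace E := FiniteDimensional.complete ℝ E
  have h := hhat.koszul S.completeLift_symm (S.mdifferentiableAt_hField hnabla hX)
    (S.mdifferentiableAt_hField hnabla hY) (S.mdifferentiableAt_hField hnabla hZ)
  rw [mvfderiv_completeLift_hField_hField, mvfderiv_completeLift_hField_hField,
    mvfderiv_completeLift_hField_hField,
    S.completeLift_mlieBracket_hField_hField_hField hnabla hX hY hZ,
    S.completeLift_mlieBracket_hField_hField_hField hnabla hX hZ hY,
    S.completeLift_mlieBracket_hField_hField_hField hnabla hY hZ hX, ← hUu] at h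
  have b := hnabla.bianchi U hX hY hZ
  have p := S.curvatureForm_pair_symm hnabla hU hX hY hZ
  have s := S.curvatureForm_swap_right hnabla hY hZ hU hX
  have l := curvatureForm_swap_left (g := S.g) (cov := nabla) X Z Y U u.1
  simp only [curvatureForm] at b p s l ⊢
  linarith

/-- Koszul's formula for ĝ is compared with the one for g. They differ by -Z g(X, Y) + g(∇_Z X, Y) +
g(∇_Z Y, X), which is zero. -/
theorem completeLift_nablaHat_hField_hField_vField (hnabla : IsLeviCivita S.g nabla)
    (hhat : IsLeviCivita (completeLift S.g nabla) nablaHat)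
    (hX : CMDiffAt ∞ (T% X) u.1) (hY : CMDiffAt ∞ (T% Y) u.1) (hZ : CMDiffAt ∞ (T% Z) u.1) :
    completeLift S.g nabla u (nablaHat (hField nabla Y) u (hField nabla X u)) (vField Z u)
      = S.g u.1 (nabla Y u.1 (X u.1)) (Z u.1) := by
  have hXd := hX.mdifferentiableAt (n := ∞) (by simp)
  have hYd := hY.mdifferentiableAt (n := ∞) (by simp)
  have hZd := hZ.mdifferentiableAt (n := ∞) (by simp)
  have h := hhat.koszul S.completeLift_symm (S.mdifferentiableAt_hField hnabla hX)
    (S.mdifferentiableAt_hField hnabla hY) (mdifferentiableAt_vField hZ)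
  rw [S.mvfderiv_completeLift_vField_right nabla _ hY hZ,
    S.mvfderiv_completeLift_vField_right nabla _ hX hZ,
    mvfderiv_completeLift_hField_hField, dProj_hField, dProj_hField,
    S.completeLift_mlieBracket_hField_hField_vField hnabla hX hY,
    S.completeLift_mlieBracket_hField_vField_hField hnabla hX hZ hY,
    S.completeLift_mlieBracket_hField_vField_hField hnabla hY hZ hX] at h
  have k := hnabla.koszul S.g_symm hXd hYd hZd
  have m := hnabla.metric Z X Y u.1 hXd hYd
  have t := hnabla.torsion_free X Z u.1 hXd hZd
  have t' := hnabla.torsion_free Y Z u.1 hYd hZd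
  rw [← t, ← t'] at k
  simp only [map_sub, _root_.sub_apply] at k
  rw [S.g_symm u.1 (X u.1)] at m
  linarith

/-- Metric compatibility of ∇̂ transfers the previous pairing from Z^H to Y^V. -/
theorem completeLift_nablaHat_hField_vField_hField (hnabla : IsLeviCivita S.g nabla)
    (hhat : IsLeviCivita (completeLift S.g nabla) nablaHat)
    (hX : CMDiffAt ∞ (T% X) u.1) (hY : CMDiffAt ∞ (T% Y) u.1) (hZ : CMDiffAt ∞ (T% Z) u.1) :
    completeLift S.g nabla u (nablaHat (vField Y) u (hField nabla X u)) (hField nabla Z u)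
      = S.g u.1 (nabla Y u.1 (X u.1)) (Z u.1) := by
  have hYd := hY.mdifferentiableAt (n := ∞) (by simp)
  have hZd := hZ.mdifferentiableAt (n := ∞) (by simp)
  have h := hhat.metric (hField nabla X) (vField Y) (hField nabla Z) u
    (mdifferentiableAt_vField hY) (S.mdifferentiableAt_hField hnabla hZ)
  rw [S.mvfderiv_completeLift_vField_left nabla _ hY hZ, dProj_hField,
    S.completeLift_symm u (vField Y u),
    S.completeLift_nablaHat_hField_hField_vField hnabla hhat hX hZ hY] at h
  have m := hnabla.metric X Y Z u.1 hYd hZd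
  rw [S.g_symm u.1 (Y u.1)] at m
  linarith

theorem completeLift_nablaHat_hField_vField_vField (hnabla : IsLeviCivita S.g nabla)
    (hhat : IsLeviCivita (completeLift S.g nabla) nablaHat)
    (hX : CMDiffAt ∞ (T% X) u.1) (hY : CMDiffAt ∞ (T% Y) u.1) (hZ : CMDiffAt ∞ (T% Z) u.1) :
    completeLift S.g nabla u (nablaHat (vField Y) u (hField nabla X u)) (vField Z u) = 0 := by
  have h := hhat.koszul S.completeLift_symm (S.mdifferentiableAt_hField hnabla hX)
    (mdifferentiableAt_vField hY) (mdifferentiableAt_vField hZ)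
  rw [mvfderiv_completeLift_vField_vField, S.mvfderiv_completeLift_vField_right nabla _ hX hZ,
    S.mvfderiv_completeLift_vField_right nabla _ hX hY, dProj_vField, dProj_vField,
    S.completeLift_mlieBracket_hField_vField_vField hnabla hX hY,
    S.completeLift_mlieBracket_hField_vField_vField hnabla hX hZ,
    S.completeLift_mlieBracket_vField_vField_hField hnabla hY hZ hX, map_zero, map_zero] at h
  linarith

/-- By torsion-freeness ∇̂_{X^V} Y^H = ∇̂_{Y^H} X^V - [Y^H, X^V], and both terms pair with Z^H to
g(∇_Y X, Z). -/
theorem completeLift_nablaHat_vField_hField_hField (hnabla : IsLeviCivita S.g nabla)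
    (hhat : IsLeviCivita (completeLift S.g nabla) nablaHat)
    (hX : CMDiffAt ∞ (T% X) u.1) (hY : CMDiffAt ∞ (T% Y) u.1) (hZ : CMDiffAt ∞ (T% Z) u.1) :
    completeLift S.g nabla u (nablaHat (hField nabla Y) u (vField X u)) (hField nabla Z u) = 0 := by
  have t := hhat.torsion_free (hField nabla Y) (vField X) u (S.mdifferentiableAt_hField hnabla hY)
    (mdifferentiableAt_vField hX)
  have h := S.completeLift_mlieBracket_hField_vField_hField hnabla hY hX hZ
  rw [← t, map_sub, _root_.sub_apply,
    S.completeLift_nablaHat_hField_vField_hField hnabla hhat hY hX hZ] at h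
  linarith

theorem completeLift_nablaHat_vField_hField_vField (hnabla : IsLeviCivita S.g nabla)
    (hhat : IsLeviCivita (completeLift S.g nabla) nablaHat)
    (hX : CMDiffAt ∞ (T% X) u.1) (hY : CMDiffAt ∞ (T% Y) u.1) (hZ : CMDiffAt ∞ (T% Z) u.1) :
    completeLift S.g nabla u (nablaHat (hField nabla Y) u (vField X u)) (vField Z u) = 0 := by
  have t := hhat.torsion_free (hField nabla Y) (vField X) u (S.mdifferentiableAt_hField hnabla hY)
    (mdifferentiableAt_vField hX)
  have h := S.completeLift_mlieBracket_hField_vField_vField hnabla hY hX Z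
  rw [← t, map_sub, _root_.sub_apply,
    S.completeLift_nablaHat_hField_vField_vField hnabla hhat hY hX hZ] at h
  linarith

theorem completeLift_nablaHat_vField_vField_hField (hnabla : IsLeviCivita S.g nabla)
    (hhat : IsLeviCivita (completeLift S.g nabla) nablaHat)
    (hX : CMDiffAt ∞ (T% X) u.1) (hY : CMDiffAt ∞ (T% Y) u.1) (hZ : CMDiffAt ∞ (T% Z) u.1) :
    completeLift S.g nabla u (nablaHat (vField Y) u (vField X u)) (hField nabla Z u) = 0 := by
  have h := hhat.metric (vField X) (vField Y) (hField nabla Z) u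
    (mdifferentiableAt_vField hY) (S.mdifferentiableAt_hField hnabla hZ)
  rw [S.mvfderiv_completeLift_vField_left nabla _ hY hZ, dProj_vField, map_zero,
    S.completeLift_symm u (vField Y u),
    S.completeLift_nablaHat_vField_hField_vField hnabla hhat hX hZ hY] at h
  linarith

theorem completeLift_nablaHat_vField_vField_vField
    (hhat : IsLeviCivita (completeLift S.g nabla) nablaHat)
    (hX : CMDiffAt ∞ (T% X) u.1) (hY : CMDiffAt ∞ (T% Y) u.1) (hZ : CMDiffAt ∞ (T% Z) u.1) :
    completeLift S.g nabla u (nablaHat (vField Y) u (vField X u)) (vField Z u) = 0 := by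
  have h := hhat.koszul S.completeLift_symm (mdifferentiableAt_vField hX)
    (mdifferentiableAt_vField hY) (mdifferentiableAt_vField hZ)
  rw [mvfderiv_completeLift_vField_vField, mvfderiv_completeLift_vField_vField,
    mvfderiv_completeLift_vField_vField,
    S.completeLift_mlieBracket_vField_vField_vField hX hY,
    S.completeLift_mlieBracket_vField_vField_vField hX hZ,
    S.completeLift_mlieBracket_vField_vField_vField hY hZ] at h
  linarith

end AlmostNordenStructure

end CompleteLiftLeviCivita

end

/-! ### The components of the three structure tensors. -/

theorem mainTheorem5 {E : Type*} [NormedAddCommGroup E] [NormedSpace ℝ E] [FiniteDimensional ℝ E]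
    {M : Type*} [TopologicalSpace M] [ChartedSpace E M] [IsManifold 𝓘(ℝ, E) ∞ M]
    (S : AlmostNordenStructure E M)
    (nabla : CovariantDerivative 𝓘(ℝ, E) E (TangentSpace 𝓘(ℝ, E) : M → Type _))
    (hnabla : IsLeviCivita S.g nabla)
    (nablaHat : CovariantDerivative 𝓘(ℝ, E).tangent (E × E)
      (TangentSpace 𝓘(ℝ, E).tangent : TangentBundle 𝓘(ℝ, E) M → Type _))
    (hnablaHat : IsLeviCivita (completeLift S.g nabla) nablaHat)
    (u : TangentBundle 𝓘(ℝ, E) M)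
    (U X Y Z : Π x : M, TangentSpace 𝓘(ℝ, E) x)
    (hU : CMDiffAt ∞ (T% U) u.1) (hX : CMDiffAt ∞ (T% X) u.1)
    (hY : CMDiffAt ∞ (T% Y) u.1) (hZ : CMDiffAt ∞ (T% Z) u.1)
    (hUu : U u.1 = u.2) :
    let F := structureTensor S.g nabla S.J
    let R := curvatureForm S.g nabla
    let JY : Π x : M, TangentSpace 𝓘(ℝ, E) x := fun x ↦ S.J x (Y x)
    let JZ : Π x : M, TangentSpace 𝓘(ℝ, E) x := fun x ↦ S.J x (Z x)
    let gHat := completeLift S.g nabla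
    let F₁ := structureTensor gHat nablaHat (J1 nabla S.J)
    let F₂ := structureTensor gHat nablaHat (J2 nabla)
    let F₃ := structureTensor gHat nablaHat (J3 nabla S.J)
    let XH := hField nabla X
    let YH := hField nabla Y
    let ZH := hField nabla Z
    let XV := vField X
    let YV := vField Y
    let ZV := vField Z
    (F₁ XH YH ZH u = -R U X JY Z u.1 - R U X Y JZ u.1 ∧
      F₁ XH YH ZV u = -F X Y Z u.1 ∧
      F₁ XH YV ZH u = F X Y Z u.1 ∧
      F₁ XH YV ZV u = 0 ∧
      F₁ XV YH ZH u = 0 ∧ F₁ XV YH ZV u = 0 ∧ F₁ XV YV ZH u = 0 ∧ F₁ XV YV ZV u = 0) ∧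
    (F₂ XH YH ZH u = 0 ∧
      F₂ XH YH ZV u = R U X Y Z u.1 ∧
      F₂ XH YV ZH u = -R U X Y Z u.1 ∧
      F₂ XH YV ZV u = 0 ∧
      F₂ XV YH ZH u = 0 ∧ F₂ XV YH ZV u = 0 ∧ F₂ XV YV ZH u = 0 ∧ F₂ XV YV ZV u = 0) ∧
    (F₃ XH YH ZH u = F X Y Z u.1 ∧
      F₃ XH YH ZV u = -R U X Y JZ u.1 ∧
      F₃ XH YV ZH u = R U X JY Z u.1 ∧
      F₃ XH YV ZV u = F X Y Z u.1 ∧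
      F₃ XV YH ZH u = 0 ∧ F₃ XV YH ZV u = 0 ∧ F₃ XV YV ZH u = 0 ∧ F₃ XV YV ZV u = 0) := by
  intro F R JY JZ gHat F₁ F₂ F₃ XH YH ZH XV YV ZV
  have hJY : CMDiffAt ∞ (T% JY) u.1 := S.contMDiffAt_J_apply hY
  have hJZ : CMDiffAt ∞ (T% JZ) u.1 := S.contMDiffAt_J_apply hZ
  -- Self-adjointness of J gives F the same shape as `expand` followed by an adjoint identity: a
  -- difference of two pairings with J on Y and on Z.
  have hF : F X Y Z u.1
      = S.g u.1 (nabla JY u.1 (X u.1)) (Z u.1) - S.g u.1 (nabla Y u.1 (X u.1)) (JZ u.1) := by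
    change S.g u.1 (nabla JY u.1 (X u.1) - S.J u.1 (nabla Y u.1 (X u.1))) (Z u.1) = _
    rw [map_sub, _root_.sub_apply, S.g_J_left]
  have expand : ∀ (K : Π w : TangentBundle 𝓘(ℝ, E) M,
      TangentSpace 𝓘(ℝ, E).tangent w →L[ℝ] TangentSpace 𝓘(ℝ, E).tangent w)
      (A B C : Π w : TangentBundle 𝓘(ℝ, E) M, TangentSpace 𝓘(ℝ, E).tangent w),
      structureTensor gHat nablaHat K A B C u
        = gHat u (nablaHat (fun w ↦ K w (B w)) u (A u)) (C u)
          - gHat u (K u (nablaHat B u (A u))) (C u) := fun K A B C ↦ by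
    simp only [structureTensor, map_sub, _root_.sub_apply]
  have hhh : ∀ {B C : Π x : M, TangentSpace 𝓘(ℝ, E) x}, CMDiffAt ∞ (T% B) u.1 →
      CMDiffAt ∞ (T% C) u.1 → gHat u (nablaHat (hField nabla B) u (XH u)) (hField nabla C u)
        = R U X B C u.1 := fun hB hC ↦
    S.completeLift_nablaHat_hField_hField_hField hnabla hnablaHat hU hX hB hC hUu
  have hhv : ∀ {B C : Π x : M, TangentSpace 𝓘(ℝ, E) x}, CMDiffAt ∞ (T% B) u.1 →
      CMDiffAt ∞ (T% C) u.1 → gHat u (nablaHat (hField nabla B) u (XH u)) (vField C u)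
        = S.g u.1 (nabla B u.1 (X u.1)) (C u.1) := fun hB hC ↦
    S.completeLift_nablaHat_hField_hField_vField hnabla hnablaHat hX hB hC
  have hvh : ∀ {B C : Π x : M, TangentSpace 𝓘(ℝ, E) x}, CMDiffAt ∞ (T% B) u.1 →
      CMDiffAt ∞ (T% C) u.1 → gHat u (nablaHat (vField B) u (XH u)) (hField nabla C u)
        = S.g u.1 (nabla B u.1 (X u.1)) (C u.1) := fun hB hC ↦
    S.completeLift_nablaHat_hField_vField_hField hnabla hnablaHat hX hB hC
  have hvv : ∀ {B C : Π x : M, TangentSpace 𝓘(ℝ, E) x}, CMDiffAt ∞ (T% B) u.1 →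
      CMDiffAt ∞ (T% C) u.1 → gHat u (nablaHat (vField B) u (XH u)) (vField C u) = 0 := fun hB hC ↦
    S.completeLift_nablaHat_hField_vField_vField hnabla hnablaHat hX hB hC
  have vhh : ∀ {B C : Π x : M, TangentSpace 𝓘(ℝ, E) x}, CMDiffAt ∞ (T% B) u.1 →
      CMDiffAt ∞ (T% C) u.1 → gHat u (nablaHat (hField nabla B) u (XV u)) (hField nabla C u) = 0 :=
    fun hB hC ↦ S.completeLift_nablaHat_vField_hField_hField hnabla hnablaHat hX hB hC
  have vhv : ∀ {B C : Π x : M, TangentSpace 𝓘(ℝ, E) x}, CMDiffAt ∞ (T% B) u.1 →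
      CMDiffAt ∞ (T% C) u.1 → gHat u (nablaHat (hField nabla B) u (XV u)) (vField C u) = 0 :=
    fun hB hC ↦ S.completeLift_nablaHat_vField_hField_vField hnabla hnablaHat hX hB hC
  have vvh : ∀ {B C : Π x : M, TangentSpace 𝓘(ℝ, E) x}, CMDiffAt ∞ (T% B) u.1 →
      CMDiffAt ∞ (T% C) u.1 → gHat u (nablaHat (vField B) u (XV u)) (hField nabla C u) = 0 :=
    fun hB hC ↦ S.completeLift_nablaHat_vField_vField_hField hnabla hnablaHat hX hB hC
  have vvv : ∀ {B C : Π x : M, TangentSpace 𝓘(ℝ, E) x}, CMDiffAt ∞ (T% B) u.1 →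
      CMDiffAt ∞ (T% C) u.1 → gHat u (nablaHat (vField B) u (XV u)) (vField C u) = 0 :=
    fun hB hC ↦ S.completeLift_nablaHat_vField_vField_vField hnablaHat hX hB hC
  -- Needed for the two minus signs in J₁Y^H = -(JY)^H and J₂Y^V = -Y^H.
  have negH : ∀ {B : Π x : M, TangentSpace 𝓘(ℝ, E) x}, CMDiffAt ∞ (T% B) u.1 → ∀ ξ η,
      gHat u (nablaHat (fun w ↦ -hField nabla B w) u ξ) η
        = -gHat u (nablaHat (hField nabla B) u ξ) η := fun hB ξ η ↦ by
    rw [nablaHat.neg_apply (S.mdifferentiableAt_hField hnabla hB), map_neg, _root_.neg_apply]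
  have f1h : (fun w ↦ J1 nabla S.J w (YH w)) = fun w ↦ -hField nabla JY w := J1_hField ..
  have f1v : (fun w ↦ J1 nabla S.J w (YV w)) = vField JY := J1_vField ..
  have f2h : (fun w ↦ J2 nabla w (YH w)) = vField Y := J2_hField ..
  have f2v : (fun w ↦ J2 nabla w (YV w)) = fun w ↦ -hField nabla Y w := J2_vField ..
  have f3h : (fun w ↦ J3 nabla S.J w (YH w)) = vField JY := J3_hField ..
  have f3v : (fun w ↦ J3 nabla S.J w (YV w)) = hField nabla JY := J3_vField ..
  have j1h (ξ) : gHat u (J1 nabla S.J u ξ) (ZH u) = gHat u ξ (hField nabla JZ u) :=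
    S.completeLift_J1_hField ..
  have j1v (ξ) : gHat u (J1 nabla S.J u ξ) (ZV u) = -gHat u ξ (vField JZ u) :=
    S.completeLift_J1_vField ..
  have j2h (ξ) : gHat u (J2 nabla u ξ) (ZH u) = gHat u ξ (vField Z u) :=
    S.completeLift_J2_hField ..
  have j2v (ξ) : gHat u (J2 nabla u ξ) (ZV u) = -gHat u ξ (hField nabla Z u) :=
    S.completeLift_J2_vField ..
  have j3h (ξ) : gHat u (J3 nabla S.J u ξ) (ZH u) = gHat u ξ (vField JZ u) :=
    S.completeLift_J3_hField ..
  have j3v (ξ) : gHat u (J3 nabla S.J u ξ) (ZV u) = gHat u ξ (hField nabla JZ u) :=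
    S.completeLift_J3_vField ..
  refine ⟨⟨?_, ?_, ?_, ?_, ?_, ?_, ?_, ?_⟩, ⟨?_, ?_, ?_, ?_, ?_, ?_, ?_, ?_⟩,
    ⟨?_, ?_, ?_, ?_, ?_, ?_, ?_, ?_⟩⟩
  · change structureTensor gHat nablaHat _ XH YH ZH u = _
    rw [expand, f1h, j1h, negH hJY, hhh hJY hZ, hhh hY hJZ]
  · change structureTensor gHat nablaHat _ XH YH ZV u = _
    rw [expand, f1h, j1v, negH hJY, hhv hJY hZ, hhv hY hJZ]
    linarith
  · change structureTensor gHat nablaHat _ XH YV ZH u = _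
    rw [expand, f1v, j1h, hvh hJY hZ, hvh hY hJZ]
    linarith
  · change structureTensor gHat nablaHat _ XH YV ZV u = _
    rw [expand, f1v, j1v, hvv hJY hZ, hvv hY hJZ]
    linarith
  · change structureTensor gHat nablaHat _ XV YH ZH u = _
    rw [expand, f1h, j1h, negH hJY, vhh hJY hZ, vhh hY hJZ]
    linarith
  · change structureTensor gHat nablaHat _ XV YH ZV u = _
    rw [expand, f1h, j1v, negH hJY, vhv hJY hZ, vhv hY hJZ]
    linarith
  · change structureTensor gHat nablaHat _ XV YV ZH u = _
    rw [expand, f1v, j1h, vvh hJY hZ, vvh hY hJZ]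
    linarith
  · change structureTensor gHat nablaHat _ XV YV ZV u = _
    rw [expand, f1v, j1v, vvv hJY hZ, vvv hY hJZ]
    linarith
  · change structureTensor gHat nablaHat _ XH YH ZH u = _
    rw [expand, f2h, j2h, hvh hY hZ, hhv hY hZ]
    linarith
  · change structureTensor gHat nablaHat _ XH YH ZV u = _
    rw [expand, f2h, j2v, hvv hY hZ, hhh hY hZ]
    linarith
  · change structureTensor gHat nablaHat _ XH YV ZH u = _
    rw [expand, f2v, j2h, negH hY, hhh hY hZ, hvv hY hZ]
    linarith
  · change structureTensor gHat nablaHat _ XH YV ZV u = _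
    rw [expand, f2v, j2v, negH hY, hhv hY hZ, hvh hY hZ]
    linarith
  · change structureTensor gHat nablaHat _ XV YH ZH u = _
    rw [expand, f2h, j2h, vvh hY hZ, vhv hY hZ]
    linarith
  · change structureTensor gHat nablaHat _ XV YH ZV u = _
    rw [expand, f2h, j2v, vvv hY hZ, vhh hY hZ]
    linarith
  · change structureTensor gHat nablaHat _ XV YV ZH u = _
    rw [expand, f2v, j2h, negH hY, vhh hY hZ, vvv hY hZ]
    linarith
  · change structureTensor gHat nablaHat _ XV YV ZV u = _
    rw [expand, f2v, j2v, negH hY, vhv hY hZ, vvh hY hZ]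
    linarith
  · change structureTensor gHat nablaHat _ XH YH ZH u = _
    rw [expand, f3h, j3h, hvh hJY hZ, hhv hY hJZ]
    linarith
  · change structureTensor gHat nablaHat _ XH YH ZV u = _
    rw [expand, f3h, j3v, hvv hJY hZ, hhh hY hJZ]
    linarith
  · change structureTensor gHat nablaHat _ XH YV ZH u = _
    rw [expand, f3v, j3h, hhh hJY hZ, hvv hY hJZ]
    linarith
  · change structureTensor gHat nablaHat _ XH YV ZV u = _
    rw [expand, f3v, j3v, hhv hJY hZ, hvh hY hJZ]
    linarith
  · change structureTensor gHat nablaHat _ XV YH ZH u = _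
    rw [expand, f3h, j3h, vvh hJY hZ, vhv hY hJZ]
    linarith
  · change structureTensor gHat nablaHat _ XV YH ZV u = _
    rw [expand, f3h, j3v, vvv hJY hZ, vhh hY hJZ]
    linarith
  · change structureTensor gHat nablaHat _ XV YV ZH u = _
    rw [expand, f3v, j3h, vhh hJY hZ, vvv hY hJZ]
    linarith
  · change structureTensor gHat nablaHat _ XV YV ZV u = _
    rw [expand, f3v, j3v, vhv hJY hZ, vvh hY hJZ]
    linarith
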